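/- Let $G$ be a (finite-dimensional real, Hausdorff, smooth) Lie group with Lie algebra $\mathfrak g=T_eG$, and for $v\in\mathfrak g$ let $v^L_a=(dL_a)_e v$ be the associated left-invariant vector field; the bracket is $[v,w]=[v^L,w^L]_e$. For a diffeomorphism $\Phi$ of a manifold $M$, its lift to $T^*M$ is $\hat\Phi(p)=(\Phi^{-1})^*p\in T^*_{\Phi(q)}M$ for $p\in T_q^*M$; if $X$ is a smooth vector field on $M$ with flow $\phi_X^t$, its cotangent lift $\hat X$ is the vector field on $T^*M$ given by $\hat X_p=\frac{d}{dt}\big|_{t=0}\widehat{\phi_X^t}(p)$. **(1)** The map $\Theta:G\times\mathfrak g^*\to T^*G$, $(a,\psi)\mapsto L_{a^{-1}}^*\psi = \psi\circ (dL_{a^{-1}})_a\in T_a^*G$, is a diffeomorphism. For every $v\in\mathfrak g$, the field $v^L$ is complete with flow $\phi^t_{v^L}=R_{\exp(tv)}:a\mapsto a\exp(tv)$, and under the identification $\Theta$ (and $T_\psi\mathfrak g^*=\mathfrak g^*$): - the cotangent lift of $v^L$ is $\widehat{v^L}=(v^L,\mathrm{ad}^*_v)$, i.e. at $(a,\psi)$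 it equals $(v^L_a,\ \psi\circ \mathrm{ad}_v)$, where $\mathrm{ad}_v w=[v,w]$; - the lift of the flow is $\widehat{\phi^t_{v^L}}(a,\psi)=(a\exp(tv),\ \mathrm{Ad}^*_{\exp(tv)}\psi)$, where $\mathrm{Ad}^*_g\psi=\psi\circ\mathrm{Ad}_g$ and $\mathrm{Ad}_g=d(x\mapsto gxg^{-1})_e$; and these maps form the smooth global flow of $\widehat{v^L}$. **(2)** Let $v_1,\dots,v_n$ be a basis of $\mathfrak g$ with dual basis $\eta_1,\dots,\eta_n$ and structure constants $c_{ij}^k$, $[v_i,v_j]=\sum_k c_{ij}^k v_k$. Then $(a,\beta)\mapsto L_{a^{-1}}^*\big(\sum_k\beta_k\eta_k\big)$ is a diffeomorphism $G\times\mathbb R^n\to T^*G$. Let $f_1,\dots,f_n\in C^\infty(G)$ and let $V=\sum_i f_i v_i^L$ have smooth flow $\phi$ on some flow domain (for instance, $V$ complete and $\phi$ its global flow). Under this identification the cotangent lift of $V$ is $$\hat V_{(a,\beta)}=\Big(\sum_{i} f_i(a)\,(v_i^L)_a\,,\ \Big(\sum_{i,k} f_i(a)\,c_{ij}^k\,\beta_k-\sum_{i}\,v_j^L(f_i)(a)\,\beta_i\Big)_{j=1}^n\Big).$$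 If $V$ is complete, then for all $a\in G$ and $\beta^0\in\mathbb R^n$ the lifted flow has the form $\widehat{\phi^t}(a,\beta^0)=(\phi^t(a),\beta(t))$, where $\beta(0)=\beta^0$ and $\beta$ solves the adjoint equation $$\dot\beta_j(t)=\sum_{i,k} f_i(\phi^t(a))\,c_{ij}^k\,\beta_k(t)-\sum_i v_j^L(f_i)(\phi^t(a))\,\beta_i(t),\qquad j=1,\dots,n.$$ -/

import Mathlib

open Bundle Set Function
open scoped Manifold ContDiff Topology

noncomputable section

/-- The cotangent bundle `T*M`, with the topology and the smooth structure of Mathlib's bundle of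
continuous linear maps from `TM` to the trivial line bundle. Its model fibre is `E* = E →L[ℝ] ℝ`. -/
abbrev CotangentBundle {E H : Type*} [NormedAddCommGroup E] [NormedSpace ℝ E]
    [TopologicalSpace H] (I : ModelWithCorners ℝ E H)
    (M : Type*) [TopologicalSpace M] [ChartedSpace H M] : Type _ :=
  TotalSpace (E →L[ℝ] ℝ) (fun x : M => TangentSpace I x →L[ℝ] Trivial M ℝ x)

section Manifold

variable {E H M : Type*} [NormedAddCommGroup E] [NormedSpace ℝ E] [TopologicalSpace H]
  (I : ModelWithCorners ℝ E H) [TopologicalSpace M] [ChartedSpace H M]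

/-- `φ` is a (smooth) flow of the vector field `X`, with flow domain `D ⊆ ℝ × M`: `D` is open, each
slice `{t | (t, q) ∈ D}` is an interval containing `0`, `φ` is smooth on `D`, `φ 0 = id`, and
`t ↦ φ t q` is an integral curve of `X`. The flow is global when `D = univ`. -/
structure IsFlowOn (X : (q : M) → TangentSpace I q) (D : Set (ℝ × M)) (φ : ℝ → M → M) : Prop where
  isOpen : IsOpen D
  zero_mem : ∀ q, ((0 : ℝ), q) ∈ D
  ordConnected : ∀ q, OrdConnected {t : ℝ | (t, q) ∈ D}
  contMDiffOn : ContMDiffOn (𝓘(ℝ, ℝ).prod I) I ∞ (uncurry φ) D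
  map_zero : ∀ q, φ 0 q = q
  hasMFDerivAt : ∀ t q, (t, q) ∈ D →
    HasMFDerivAt 𝓘(ℝ, ℝ) I (fun s => φ s q) t ((1 : ℝ →L[ℝ] ℝ).smulRight (X (φ t q)))

/-- `φ` is a smooth global flow of `X` (in particular `X` is complete). -/
abbrev IsGlobalFlow (X : (q : M) → TangentSpace I q) (φ : ℝ → M → M) : Prop :=
  IsFlowOn I X univ φ

/-- The lift of a (local) diffeomorphism `Φ` to the cotangent bundle,
`p ∈ T*_q M ↦ p ∘ (dΦ_q)⁻¹ ∈ T*_{Φ q} M`, i.e. the pullback of `p` by `Φ⁻¹`. -/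
def cotangentMap (Φ : M → M) (p : CotangentBundle I M) : CotangentBundle I M :=
  ⟨Φ p.1, p.2.comp (mfderiv I I Φ p.1).inverse⟩

/-- For a diffeomorphism `Φ`, the lift is the pullback by `Φ⁻¹`. -/
theorem cotangentMap_diffeomorph (Φ : Diffeomorph I I M M ∞)
    (p : CotangentBundle I M) (w : TangentSpace I (Φ p.1)) :
    (cotangentMap I Φ p).2 w =
      p.2 ((mfderiv I I Φ.symm (Φ p.1) : TangentSpace I (Φ p.1) →L[ℝ] TangentSpace I p.1) w) := by
  have h1 : HasMFDerivAt I I Φ p.1 (mfderiv I I Φ p.1) :=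
    (Φ.mdifferentiable (by simp) p.1).hasMFDerivAt
  have h2 : HasMFDerivAt I I Φ.symm (Φ p.1) (mfderiv I I Φ.symm (Φ p.1)) :=
    (Φ.symm.mdifferentiable (by simp) (Φ p.1)).hasMFDerivAt
  have h3 : HasMFDerivAt I I Φ (Φ.symm (Φ p.1)) (mfderiv I I Φ p.1 : E →L[ℝ] E) := by
    rw [Φ.symm_apply_apply]; exact h1
  have e1 := hasMFDerivAt_unique ((h2.comp p.1 h1).congr_of_eventuallyEq
    (Filter.Eventually.of_forall fun x => (Φ.symm_apply_apply x).symm)) (hasMFDerivAt_id p.1)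
  have e2 := hasMFDerivAt_unique ((h3.comp (Φ p.1) h2).congr_of_eventuallyEq
    (Filter.Eventually.of_forall fun x => (Φ.apply_symm_apply x).symm)) (hasMFDerivAt_id (Φ p.1))
  have e : (mfderiv I I Φ p.1).inverse =
      (mfderiv I I Φ.symm (Φ p.1) : TangentSpace I (Φ p.1) →L[ℝ] TangentSpace I p.1) :=
    ContinuousLinearMap.inverse_eq e2 e1
  change p.2 ((mfderiv I I Φ p.1).inverse w) = _
  rw [e]; rfl

variable [IsManifold I 1 M]

/-- `Y` is the cotangent lift of the vector field `X`: with `φ` the flow of `X`, the value of `Y` at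
each covector `p` is the velocity at `t = 0` of the curve `t ↦ (lift of φ t) p` in `T*M`. (Flows of a
smooth field on a Hausdorff manifold agree on common domains, so the choice is immaterial.) -/
def IsCotangentLift (X : (q : M) → TangentSpace I q)
    (Y : (p : CotangentBundle I M) → TangentSpace (I.prod 𝓘(ℝ, E →L[ℝ] ℝ)) p) : Prop :=
  ∃ (D : Set (ℝ × M)) (φ : ℝ → M → M), IsFlowOn I X D φ ∧ ∀ p : CotangentBundle I M,
    HasMFDerivAt 𝓘(ℝ, ℝ) (I.prod 𝓘(ℝ, E →L[ℝ] ℝ)) (fun t => cotangentMap I (φ t) p) 0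
      ((1 : ℝ →L[ℝ] ℝ).smulRight (Y p))

end Manifold

section LieGroup

variable {E H G : Type*} [NormedAddCommGroup E] [NormedSpace ℝ E] [TopologicalSpace H]
  (I : ModelWithCorners ℝ E H) [TopologicalSpace G] [ChartedSpace H G] [Group G]

instance instLieGroupMinSmoothness [LieGroup I ∞ G] : LieGroup I (minSmoothness ℝ 3) G := by
  rw [minSmoothness_of_isRCLikeNormedField]; infer_instance

/-- `γ` is the one-parameter subgroup of `G` with initial velocity `v`. -/
structure IsOneParameterSubgroup (γ : ℝ → G) (v : GroupLieAlgebra I G) : Prop where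
  map_add : ∀ s t, γ (s + t) = γ s * γ t
  contMDiff : ContMDiff 𝓘(ℝ, ℝ) I ∞ γ
  hasMFDerivAt : HasMFDerivAt 𝓘(ℝ, ℝ) I γ 0 ((1 : ℝ →L[ℝ] ℝ).smulRight v)

/-- The exponential map: `exp v = γ 1`, where `γ` is the one-parameter subgroup with initial
velocity `v`. -/
def lieExp (v : GroupLieAlgebra I G) : G :=
  Classical.epsilon (fun γ : ℝ → G => IsOneParameterSubgroup I γ v) 1

/-- `Ad_g`, the differential at the identity of the conjugation `x ↦ g x g⁻¹`. -/
def lieAd (g : G) : GroupLieAlgebra I G →L[ℝ] GroupLieAlgebra I G :=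
  mfderiv I I (fun x : G => g * x * g⁻¹) 1

/-- `Ad*_g`, the transpose of `Ad_g`. The dual `𝔤*` of the Lie algebra is `E →L[ℝ] ℝ`, as the
tangent space `𝔤 = T_1 G` is by definition a copy of `E`. -/
def lieCoAd (g : G) (ψ : E →L[ℝ] ℝ) : E →L[ℝ] ℝ := ψ.comp (lieAd I g)

/-- `ad*_v`, the transpose of `ad_v : w ↦ [v, w]`. -/
def coad [FiniteDimensional ℝ E] [LieGroup I ∞ G] (v : GroupLieAlgebra I G) (ψ : E →L[ℝ] ℝ) :
    E →L[ℝ] ℝ :=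
  LinearMap.toContinuousLinearMap (E := E)
    ((ψ : E →ₗ[ℝ] ℝ) ∘ₗ (LieAlgebra.ad ℝ (GroupLieAlgebra I G) v : E →ₗ[ℝ] E))

/-- Left translation of covectors, `(a, ψ) ↦ (L_{a⁻¹})^* ψ ∈ T*_a G`. -/
def leftCovector (x : G × (E →L[ℝ] ℝ)) : CotangentBundle I G :=
  ⟨x.1, x.2.comp (mfderiv I I (fun y : G => x.1⁻¹ * y) x.1)⟩

/-- The vector field `(v^L, ad*_v)` on `G × 𝔤*`, where `v^L` is the left-invariant field of `v` and
`T_ψ 𝔤* = 𝔤*`. -/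
def leftCoadField [FiniteDimensional ℝ E] [LieGroup I ∞ G] (v : GroupLieAlgebra I G)
    (x : G × (E →L[ℝ] ℝ)) : TangentSpace (I.prod 𝓘(ℝ, E →L[ℝ] ℝ)) x :=
  (mulInvariantVectorField v x.1, coad I v x.2)

variable {ι : Type*} [Fintype ι]

/-- `∑ i, f i • v_i^L`, for `v` a basis of `𝔤` and functions `f i` on `G`. -/
def frameField (b : Module.Basis ι ℝ (GroupLieAlgebra I G)) (f : ι → G → ℝ) (a : G) :
    TangentSpace I a :=
  ∑ i, f i a • (mulInvariantVectorField (b i) a : TangentSpace I a)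

/-- The covector with coordinates `β` in the dual basis: `∑ k, β k • η_k ∈ 𝔤*`. -/
def dualCombination [FiniteDimensional ℝ E] (b : Module.Basis ι ℝ (GroupLieAlgebra I G))
    (β : ι → ℝ) : E →L[ℝ] ℝ :=
  LinearMap.toContinuousLinearMap (E := E)
    ((∑ k, β k • b.coord k : GroupLieAlgebra I G →ₗ[ℝ] ℝ) : E →ₗ[ℝ] ℝ)

/-- The structure constants: `[v_i, v_j] = ∑ k, c i j k • v_k`. -/
def structureConstant (b : Module.Basis ι ℝ (GroupLieAlgebra I G)) (i j k : ι) : ℝ :=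
  b.repr ⁅b i, b j⁆ k

/-- The derivative `X(f) = df(X)` of a function along a vector field. -/
def derivAlong (X : (a : G) → TangentSpace I a) (f : G → ℝ) (a : G) : ℝ :=
  mfderiv I 𝓘(ℝ, ℝ) f a (X a)

/-- The right-hand side of the adjoint equation: the `j`-th component is
`∑ i, ∑ k, f i * c i j k * β k - ∑ i, v_j^L (f i) * β i`. -/
def adjointRHS (b : Module.Basis ι ℝ (GroupLieAlgebra I G)) (f : ι → G → ℝ)
    (a : G) (β : ι → ℝ) (j : ι) : ℝ :=
  (∑ i, ∑ k, f i a * structureConstant I b i j k * β k) -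
    ∑ i, derivAlong I (mulInvariantVectorField (b j)) (f i) a * β i

/-- The vector field on `G × (ι → ℝ)` with components `∑ i, f i • v_i^L` and `adjointRHS`. -/
def adjointField (b : Module.Basis ι ℝ (GroupLieAlgebra I G)) (f : ι → G → ℝ)
    (x : G × (ι → ℝ)) : TangentSpace (I.prod 𝓘(ℝ, ι → ℝ)) x :=
  (frameField I b f x.1, adjointRHS I b f x.1 x.2)

end LieGroup

end

/-!
The lift of a flow `φ` of `X` transports a covector `p` at `a` to `p ∘ (dφ_t)⁻¹` at `φ_t a`, and the
left trivialization reads off a covector its values on the left-invariant fields `w^L`. So the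
coordinates of the lifted covector are `p` applied to the pullbacks `(φ_t)^* w^L`, whose derivative
at `t = 0` is the Lie bracket `[X, w^L]`. For `X = v^L` this is `[v, w]^L`, which gives `ad*_v`; for
`X = ∑ i, f i • v_i^L` the Leibniz rule for the bracket gives the structure constants and the
derivatives of the `f i`. This determines the cotangent lift, and since lifting is functorial the
lift of a global flow is again a one-parameter group, so its velocity at `t = 0` determines its
velocity at all times.
-/

noncomputable section

section VectorSpace

variable {𝕜 : Type*} [NontriviallyNormedField 𝕜] {E F : Type*} [NormedAddCommGroup E]
  [NormedSpace 𝕜 E] [NormedAddCommGroup F] [NormedSpace 𝕜 F]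

theorem hasDerivAt_ringInverse_of_eq_one {R : Type*} [NormedRing R] [NormedAlgebra 𝕜 R]
    [HasSummableGeomSeries R] {A : 𝕜 → R} {A' : R} {t : 𝕜} (hA : HasDerivAt A A' t)
    (ht : A t = 1) : HasDerivAt (fun s => Ring.inverse (A s)) (-A') t := by
  have hinv := hasFDerivAt_ringInverse (𝕜 := 𝕜) (1 : Rˣ)
  rw [Units.val_one, ← ht] at hinv
  refine (hinv.comp_hasDerivAt t hA).congr_deriv ?_
  rw [neg_apply, ContinuousLinearMap.mulLeftRight_apply, inv_one, Units.val_one, one_mul, mul_one]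

theorem hasDerivAt_clm_inverse_of_eq_id [CompleteSpace E] {A : 𝕜 → E →L[𝕜] E} {A' : E →L[𝕜] E}
    {t : 𝕜} (hA : HasDerivAt A A' t) (ht : A t = ContinuousLinearMap.id 𝕜 E) :
    HasDerivAt (fun s => (A s).inverse) (-A') t := by
  simpa only [ContinuousLinearMap.ringInverse_eq_inverse] using
    hasDerivAt_ringInverse_of_eq_one hA ht

theorem hasDerivAt_apply_mk_left {f : 𝕜 × E → F} {f' : 𝕜 × E →L[𝕜] F} {t : 𝕜} {x : E}
    (hf : HasFDerivAt f f' (t, x)) : HasDerivAt (fun s => f (s, x)) (f' (1, 0)) t :=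
  hf.comp_hasDerivAt (f := fun s : 𝕜 => (s, x)) t
    ((hasDerivAt_id t).prodMk (hasDerivAt_const t x))

theorem hasDerivAt_fderiv_of_eventually_hasDerivAt {n : WithTop ℕ∞} {f : 𝕜 × E → F} {V : E → F}
    {t : 𝕜} {x : E} (hf : ContDiffAt 𝕜 n f (t, x)) (hn : minSmoothness 𝕜 2 ≤ n)
    (hV : ∀ᶠ y in 𝓝 x, HasDerivAt (fun s => f (s, y)) (V y) t) :
    HasDerivAt (fun s => fderiv 𝕜 (fun y => f (s, y)) x) (fderiv 𝕜 V x) t := by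
  have hn₂ : 2 ≤ n := le_minSmoothness.trans hn
  have hdiff : ∀ᶠ z in 𝓝 (t, x), DifferentiableAt 𝕜 f z := by
    filter_upwards [(hf.of_le hn₂).eventually (by simp)] with z hz
      using hz.differentiableAt (by simp)
  obtain ⟨S, hS⟩ : ∃ S, HasFDerivAt (fderiv 𝕜 f) S (t, x) :=
    (hf.fderiv_right (m := 1) hn₂).differentiableAt (by simp)
  have hsymm : ∀ v w, S v w = S w v := by
    simpa only [IsSymmSndFDerivAt, hS.fderiv] using hf.isSymmSndFDerivAt hn
  have hspace : ∀ᶠ s in 𝓝 t, fderiv 𝕜 (fun y => f (s, y)) x =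
      (fderiv 𝕜 f (s, x)).comp (ContinuousLinearMap.inr 𝕜 𝕜 E) := by
    filter_upwards [(Continuous.prodMk_left x).continuousAt.eventually hdiff] with s hs
    exact (hs.hasFDerivAt.comp x (hasFDerivAt_prodMk_right s x)).fderiv
  have htime : ∀ᶠ y in 𝓝 x, V y = fderiv 𝕜 f (t, y) (1, 0) := by
    filter_upwards [hV, (Continuous.prodMk_right t).continuousAt.eventually hdiff] with y hy hdy
    exact hy.unique (hasDerivAt_apply_mk_left hdy.hasFDerivAt)
  have hV' := ((hS.comp x (hasFDerivAt_prodMk_right t x)).clm_apply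
    (hasFDerivAt_const ((1 : 𝕜), (0 : E)) x)).congr_of_eventuallyEq htime
  refine (((hasDerivAt_apply_mk_left hS).clm_comp
    (hasDerivAt_const t _)).congr_of_eventuallyEq hspace).congr_deriv ?_
  rw [hV'.fderiv]
  ext w
  simp [hsymm (1, 0) (0, w)]

theorem hasDerivAt_pullback_lieBracket [CompleteSpace E] {n : WithTop ℕ∞} {f : 𝕜 × E → E}
    {V W : E → E} {x : E} (hf : ContDiffAt 𝕜 n f (0, x)) (hn : minSmoothness 𝕜 2 ≤ n)
    (hf₀ : ∀ᶠ y in 𝓝 x, f (0, y) = y)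
    (hV : ∀ᶠ y in 𝓝 x, HasDerivAt (fun t => f (t, y)) (V y) 0) (hW : DifferentiableAt 𝕜 W x) :
    HasDerivAt (fun t => VectorField.pullback 𝕜 (fun y => f (t, y)) W x)
      (VectorField.lieBracket 𝕜 V W x) 0 := by
  have hx : f (0, x) = x := hf₀.self_of_nhds
  have hid : fderiv 𝕜 (fun y => f (0, y)) x = ContinuousLinearMap.id 𝕜 E :=
    (Filter.EventuallyEq.fderiv_eq hf₀).trans fderiv_id
  have hinv := hasDerivAt_clm_inverse_of_eq_id
    (hasDerivAt_fderiv_of_eventually_hasDerivAt hf hn hV) hid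
  have hWf : HasDerivAt (fun t => W (f (t, x))) (fderiv 𝕜 W x (V x)) 0 :=
    HasFDerivAt.comp_hasDerivAt (0 : 𝕜) (hx.symm ▸ hW.hasFDerivAt) hV.self_of_nhds
  refine (hinv.clm_apply hWf).congr_deriv ?_
  simp [hid, hx, VectorField.lieBracket_eq, neg_add_eq_sub]

end VectorSpace

section Pullback

variable {𝕜 E E' E'' H H' H'' M M' M'' : Type*} [NontriviallyNormedField 𝕜]
  [NormedAddCommGroup E] [NormedSpace 𝕜 E] [TopologicalSpace H] {I : ModelWithCorners 𝕜 E H}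
  [TopologicalSpace M] [ChartedSpace H M]
  [NormedAddCommGroup E'] [NormedSpace 𝕜 E'] [TopologicalSpace H'] {I' : ModelWithCorners 𝕜 E' H'}
  [TopologicalSpace M'] [ChartedSpace H' M']
  [NormedAddCommGroup E''] [NormedSpace 𝕜 E''] [TopologicalSpace H'']
  {I'' : ModelWithCorners 𝕜 E'' H''} [TopologicalSpace M''] [ChartedSpace H'' M'']

theorem isInvertible_mfderiv_diffeomorph {n : WithTop ℕ∞} (hn : n ≠ 0)
    (Φ : Diffeomorph I I' M M' n) (q : M) : (mfderiv I I' Φ q).IsInvertible :=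
  ⟨Φ.mfderivToContinuousLinearEquiv hn q, rfl⟩

theorem mpullback_comp_of_left {g : M' → M''} {f : M → M'} {x : M}
    (hf : MDifferentiableAt I I' f x) (hg : (mfderiv I' I'' g (f x)).IsInvertible)
    (W : (z : M'') → TangentSpace I'' z) :
    VectorField.mpullback I I'' (g ∘ f) W x =
      VectorField.mpullback I I' f (VectorField.mpullback I' I'' g W) x := by
  simp only [← VectorField.mpullbackWithin_univ]
  exact VectorField.mpullbackWithin_comp_of_left (mdifferentiableWithinAt_univ.2 hf)
    (mapsTo_univ _ _) (uniqueMDiffWithinAt_univ I) (by rwa [mfderivWithin_univ])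

theorem mpullback_comp_of_right {g : M' → M''} {f : M → M'} {x : M}
    (hg : MDifferentiableAt I' I'' g (f x)) (hf : (mfderiv I I' f x).IsInvertible)
    (W : (z : M'') → TangentSpace I'' z) :
    VectorField.mpullback I I'' (g ∘ f) W x =
      VectorField.mpullback I I' f (VectorField.mpullback I' I'' g W) x := by
  simp only [← VectorField.mpullbackWithin_univ]
  exact VectorField.mpullbackWithin_comp_of_right (mdifferentiableWithinAt_univ.2 hg)
    (mapsTo_univ _ _) (uniqueMDiffWithinAt_univ I) (by rwa [mfderivWithin_univ])

theorem mpullback_congr_apply {f : M → M'} {x : M} {V W : (y : M') → TangentSpace I' y}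
    (h : V (f x) = W (f x)) :
    VectorField.mpullback I I' f V x = VectorField.mpullback I I' f W x := by
  rw [VectorField.mpullback_apply, VectorField.mpullback_apply, h]

end Pullback

section Chart

variable {𝕜 E H M : Type*} [NontriviallyNormedField 𝕜] [NormedAddCommGroup E] [NormedSpace 𝕜 E]
  [TopologicalSpace H]
  {I : ModelWithCorners 𝕜 E H} [TopologicalSpace M] [ChartedSpace H M]

theorem inverse_mfderiv_extChartAt_symm [IsManifold I 1 M] [I.Boundaryless] {q : M} {y : E}
    (hy : y ∈ (extChartAt I q).target) :
    (mfderiv 𝓘(𝕜, E) I (extChartAt I q).symm y).inverse =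
      mfderiv I 𝓘(𝕜, E) (extChartAt I q) ((extChartAt I q).symm y) := by
  rw [← mfderivWithin_univ, ← I.range_eq_univ]
  exact ContinuousLinearMap.inverse_eq (mfderivWithin_extChartAt_symm_comp_mfderiv_extChartAt hy)
    (mfderiv_extChartAt_comp_mfderivWithin_extChartAt_symm hy)

theorem mpullback_extChartAt_symm_self [IsManifold I 1 M] [I.Boundaryless]
    (W : (q : M) → TangentSpace I q) (q : M) :
    VectorField.mpullback 𝓘(𝕜, E) I (extChartAt I q).symm W (extChartAt I q q) = W q := by
  rw [VectorField.mpullback_apply, inverse_mfderiv_extChartAt_symm (mem_extChartAt_target q),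
    extChartAt_to_inv, mfderiv_extChartAt_self]
  rfl

theorem mlieBracket_eq_lieBracket_extChartAt [IsManifold I 1 M] [I.Boundaryless]
    (V W : (q : M) → TangentSpace I q) (q : M) :
    VectorField.mlieBracket I V W q = VectorField.lieBracket 𝕜
      (VectorField.mpullback 𝓘(𝕜, E) I (extChartAt I q).symm V)
      (VectorField.mpullback 𝓘(𝕜, E) I (extChartAt I q).symm W) (extChartAt I q q) := by
  rw [← VectorField.mlieBracketWithin_univ, VectorField.mlieBracketWithin_apply,
    mfderiv_extChartAt_self, I.range_eq_univ, preimage_univ, univ_inter,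
    VectorField.mpullbackWithin_univ, VectorField.mpullbackWithin_univ]
  exact (DFunLike.congr_fun (ContinuousLinearMap.inverse_id (R := 𝕜) (M := E)) _).trans
    (congrFun VectorField.lieBracketWithin_univ _)

end Chart

section Flow

variable {E H M : Type*} [NormedAddCommGroup E] [NormedSpace ℝ E] [TopologicalSpace H]
  {I : ModelWithCorners ℝ E H} [TopologicalSpace M] [ChartedSpace H M]

namespace IsFlowOn

variable {X : (q : M) → TangentSpace I q} {D : Set (ℝ × M)} {φ : ℝ → M → M}

theorem contMDiffAt (h : IsFlowOn I X D φ) {t : ℝ} {q : M} (hq : (t, q) ∈ D) :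
    ContMDiffAt (𝓘(ℝ, ℝ).prod I) I ∞ (uncurry φ) (t, q) :=
  h.contMDiffOn.contMDiffAt (h.isOpen.mem_nhds hq)

theorem mdifferentiableAt (h : IsFlowOn I X D φ) {t : ℝ} {q : M} (hq : (t, q) ∈ D) :
    MDifferentiableAt I I (φ t) q :=
  ((h.contMDiffAt hq).mdifferentiableAt (by simp)).comp q
    (mdifferentiableAt_const.prodMk mdifferentiableAt_id)

theorem eventually_mem (h : IsFlowOn I X D φ) (q : M) : ∀ᶠ t in 𝓝 (0 : ℝ), (t, q) ∈ D :=
  (Continuous.prodMk_left q).continuousAt.eventually (h.isOpen.mem_nhds (h.zero_mem q))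

theorem tendsto_zero (h : IsFlowOn I X D φ) (q : M) :
    Filter.Tendsto (fun t => φ t q) (𝓝 0) (𝓝 q) := by
  simpa only [ContinuousAt, h.map_zero] using (h.hasMFDerivAt 0 q (h.zero_mem q)).continuousAt

end IsFlowOn

/-- The family of maps `φ t` read in the preferred chart at `q`, as a function of time and of the
coordinates. -/
def flowInChart (I : ModelWithCorners ℝ E H) (φ : ℝ → M → M) (q : M) (z : ℝ × E) : E :=
  extChartAt I q (φ z.1 ((extChartAt I q).symm z.2))

namespace IsFlowOn

variable {X : (q : M) → TangentSpace I q} {D : Set (ℝ × M)} {φ : ℝ → M → M}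

theorem contDiffAt_flowInChart (h : IsFlowOn I X D φ) {n : ℕ∞} [IsManifold I n M] [I.Boundaryless]
    (q : M) :
    ContDiffAt ℝ n (flowInChart I φ q) (0, extChartAt I q q) := by
  have hsymm : ContMDiffAt (𝓘(ℝ, ℝ).prod 𝓘(ℝ, E)) I n
      (fun z : ℝ × E => (extChartAt I q).symm z.2) (0, extChartAt I q q) :=
    ((contMDiffOn_extChartAt_symm q).contMDiffAt (extChartAt_target_mem_nhds q)).comp
      ((0 : ℝ), extChartAt I q q) contMDiffAt_snd
  have hφ : ContMDiffAt (𝓘(ℝ, ℝ).prod 𝓘(ℝ, E)) I n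
      (fun z : ℝ × E => uncurry φ (z.1, (extChartAt I q).symm z.2)) (0, extChartAt I q q) := by
    refine ContMDiffAt.comp (g := uncurry φ) _ ?_ (contMDiffAt_fst.prodMk hsymm)
    rw [extChartAt_to_inv]
    exact (h.contMDiffAt (h.zero_mem q)).of_le (mod_cast le_top)
  have hchart : ContMDiffAt I 𝓘(ℝ, E) n (extChartAt I q)
      (uncurry φ (0, (extChartAt I q).symm (extChartAt I q q))) := by
    simpa only [uncurry, extChartAt_to_inv, h.map_zero] using contMDiffAt_extChartAt
  have hcomp := hchart.comp ((0 : ℝ), extChartAt I q q) hφ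
  rw [← modelWithCornersSelf_prod, chartedSpaceSelf_prod] at hcomp
  exact hcomp.contDiffAt

theorem eventually_flowInChart_zero (h : IsFlowOn I X D φ) [I.Boundaryless] (q : M) :
    ∀ᶠ y in 𝓝 (extChartAt I q q), flowInChart I φ q (0, y) = y := by
  filter_upwards [extChartAt_target_mem_nhds q] with y hy
  rw [flowInChart, h.map_zero, (extChartAt I q).right_inv hy]

theorem eventually_hasDerivAt_flowInChart (h : IsFlowOn I X D φ) [IsManifold I 1 M]
    [I.Boundaryless] (q : M) :
    ∀ᶠ y in 𝓝 (extChartAt I q q), HasDerivAt (fun t => flowInChart I φ q (t, y))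
      (VectorField.mpullback 𝓘(ℝ, E) I (extChartAt I q).symm X y) 0 := by
  filter_upwards [extChartAt_target_mem_nhds q] with y hy
  set p := (extChartAt I q).symm y
  have hp : p ∈ (chartAt H q).source := by
    simpa only [extChartAt_source] using (extChartAt I q).map_target hy
  have hchart : HasMFDerivAt I 𝓘(ℝ, E) (extChartAt I q) (φ 0 p) _ :=
    (mdifferentiableAt_extChartAt (by rwa [h.map_zero])).hasMFDerivAt
  refine hasDerivAt_iff_hasFDerivAt.2 ((hchart.comp (0 : ℝ)
    (h.hasMFDerivAt 0 p (h.zero_mem p))).hasFDerivAt.congr_fderiv ?_)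
  rw [VectorField.mpullback_apply, inverse_mfderiv_extChartAt_symm hy, h.map_zero]
  exact ContinuousLinearMap.comp_toSpanSingleton
    (mfderiv I 𝓘(ℝ, E) (extChartAt I q) p : E →L[ℝ] E) (X p : E)

theorem eventuallyEq_pullback_flowInChart (h : IsFlowOn I X D φ) [IsManifold I 1 M]
    [I.Boundaryless] (W : (q : M) → TangentSpace I q) (q : M) :
    (fun t => VectorField.pullback ℝ (fun y => flowInChart I φ q (t, y))
      (VectorField.mpullback 𝓘(ℝ, E) I (extChartAt I q).symm W) (extChartAt I q q)) =ᶠ[𝓝 0]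
        fun t => VectorField.mpullback I I (φ t) W q := by
  have hsymm : (mfderiv 𝓘(ℝ, E) I (extChartAt I q).symm (extChartAt I q q)).IsInvertible := by
    simpa only [I.range_eq_univ, mfderivWithin_univ] using
      isInvertible_mfderivWithin_extChartAt_symm (I := I) (mem_extChartAt_target q)
  have hW : W =ᶠ[𝓝 q] VectorField.mpullback I 𝓘(ℝ, E) (extChartAt I q)
      (VectorField.mpullback 𝓘(ℝ, E) I (extChartAt I q).symm W) := by
    simpa only [nhdsWithin_univ, I.range_eq_univ, VectorField.mpullbackWithin_univ] using
      VectorField.eventuallyEq_mpullback_mpullbackWithin_extChartAt (I := I) (s := univ) (x := q) W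
  filter_upwards [h.eventually_mem q, (h.tendsto_zero q).eventually_mem
    (extChartAt_source_mem_nhds (I := I) q), (h.tendsto_zero q).eventually hW] with t htD hts htW
  have hφ : MDifferentiableAt I I (φ t) ((extChartAt I q).symm (extChartAt I q q)) := by
    rw [extChartAt_to_inv]
    exact h.mdifferentiableAt htD
  have htsymm : φ t q = (φ t ∘ (extChartAt I q).symm) (extChartAt I q q) := by
    rw [comp_apply, extChartAt_to_inv]
  have hcomp := hφ.comp _ (mdifferentiableAt_of_isInvertible_mfderiv hsymm)
  rw [htsymm] at hts htW
  rw [← mpullback_extChartAt_symm_self (VectorField.mpullback I I (φ t) W) q,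
    ← mpullback_comp_of_right hφ hsymm, mpullback_congr_apply htW,
    ← mpullback_comp_of_left hcomp (isInvertible_mfderiv_extChartAt hts)]
  exact congrFun VectorField.mpullback_eq_pullback.symm _

theorem hasDerivAt_mpullback (h : IsFlowOn I X D φ) [IsManifold I 2 M] [I.Boundaryless]
    [CompleteSpace E] {W : (q : M) → TangentSpace I q} {q : M}
    (hW : MDifferentiableAt I I.tangent (fun x => (W x : TangentBundle I M)) q) :
    HasDerivAt (F := E) (fun t => VectorField.mpullback I I (φ t) W q)
      (VectorField.mlieBracket I X W q) 0 := by
  have hWchart : DifferentiableAt ℝ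
      (VectorField.mpullback 𝓘(ℝ, E) I (extChartAt I q).symm W) (extChartAt I q q) := by
    have hWithin :=
      (hW.mdifferentiableWithinAt (s := univ)).differentiableWithinAt_mpullbackWithin_vectorField
    rw [I.range_eq_univ, VectorField.mpullbackWithin_univ, preimage_univ, univ_inter] at hWithin
    exact differentiableWithinAt_univ.1 hWithin
  rw [mlieBracket_eq_lieBracket_extChartAt]
  exact (hasDerivAt_pullback_lieBracket (h.contDiffAt_flowInChart (n := 2) q) (by simp)
    (h.eventually_flowInChart_zero q) (h.eventually_hasDerivAt_flowInChart q)
    hWchart).congr_of_eventuallyEq (h.eventuallyEq_pullback_flowInChart W q).symm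

end IsFlowOn

end Flow

section IntegralCurve

variable {E H M : Type*} [NormedAddCommGroup E] [NormedSpace ℝ E] [TopologicalSpace H]
  {I : ModelWithCorners ℝ E H} [TopologicalSpace M] [ChartedSpace H M]

theorem contMDiff_of_isMIntegralCurve [IsManifold I 1 M] {X : (q : M) → TangentSpace I q}
    (hX : ContMDiff I I.tangent ∞ (fun q => (⟨q, X q⟩ : TangentBundle I M)))
    {γ : ℝ → M} (hγ : IsMIntegralCurve γ X) : ContMDiff 𝓘(ℝ, ℝ) I ∞ γ := by
  intro t₀
  rw [contMDiffAt_infty]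
  intro n
  induction n with
  | zero => exact (contMDiff_zero_iff.2 hγ.continuous) t₀
  | succ n ih =>
    have hXchart : ContMDiffAt I 𝓘(ℝ, E) n
        (fun q => tangentCoordChange I q (γ t₀) q (X q)) (γ t₀) :=
      (contMDiffAt_totalSpace.1 (hX (γ t₀))).2.of_le (by exact_mod_cast le_top)
    rw [contMDiffAt_iff_target]
    refine ⟨hγ.continuous.continuousAt, ?_⟩
    rw [contMDiffAt_iff_contDiffAt, Nat.cast_succ, contDiffAt_succ_iff_hasFDerivAt]
    exact ⟨fun t => (1 : ℝ →L[ℝ] ℝ).smulRight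
        (tangentCoordChange I (γ t) (γ t₀) (γ t) (X (γ t))),
      ⟨_, (hγ.isMIntegralCurveAt t₀).eventually_hasDerivAt, fun t ht => ht.hasFDerivAt⟩,
      contDiffAt_const.smulRight (hXchart.comp t₀ ih).contDiffAt⟩

theorem isMIntegralCurve_of_map_add {X : (q : M) → TangentSpace I q} {φ : ℝ → M → M}
    (hadd : ∀ s t q, φ (s + t) q = φ s (φ t q))
    (hX : ∀ q, HasMFDerivAt 𝓘(ℝ, ℝ) I (fun t => φ t q) 0 ((1 : ℝ →L[ℝ] ℝ).smulRight (X q)))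
    (q : M) : IsMIntegralCurve (fun t => φ t q) X := by
  intro t
  have hshift : HasMFDerivAt 𝓘(ℝ, ℝ) 𝓘(ℝ, ℝ) (fun s : ℝ => s - t) t
      (ContinuousLinearMap.id ℝ ℝ) :=
    ((hasFDerivAt_id (𝕜 := ℝ) t).sub_const t).hasMFDerivAt
  have hzero : HasMFDerivAt 𝓘(ℝ, ℝ) I (fun s => φ s (φ t q)) (t - t)
      ((1 : ℝ →L[ℝ] ℝ).smulRight (X (φ t q))) := by
    rw [sub_self]
    exact hX (φ t q)
  exact (HasMFDerivAt.comp (f := fun s : ℝ => s - t) t hzero hshift).congr_of_eventuallyEq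
    (Filter.Eventually.of_forall fun s => by rw [comp_apply, ← hadd, sub_add_cancel])

theorem isGlobalFlow_of_map_add {X : (q : M) → TangentSpace I q} {φ : ℝ → M → M}
    (hsmooth : ContMDiff (𝓘(ℝ, ℝ).prod I) I ∞ (uncurry φ)) (hzero : ∀ q, φ 0 q = q)
    (hadd : ∀ s t q, φ (s + t) q = φ s (φ t q))
    (hX : ∀ q, HasMFDerivAt 𝓘(ℝ, ℝ) I (fun t => φ t q) 0 ((1 : ℝ →L[ℝ] ℝ).smulRight (X q))) :
    IsGlobalFlow I X φ where
  isOpen := isOpen_univ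
  zero_mem _ := mem_univ _
  ordConnected _ := ordConnected_univ
  contMDiffOn := hsmooth.contMDiffOn
  map_zero := hzero
  hasMFDerivAt t q _ := isMIntegralCurve_of_map_add hadd hX q t

namespace IsGlobalFlow

variable {X : (q : M) → TangentSpace I q} {φ : ℝ → M → M}

theorem isMIntegralCurve (h : IsGlobalFlow I X φ) (q : M) : IsMIntegralCurve (fun t => φ t q) X :=
  fun t => h.hasMFDerivAt t q (mem_univ _)

theorem contMDiff (h : IsGlobalFlow I X φ) (t : ℝ) : ContMDiff I I ∞ (φ t) :=
  (contMDiffOn_univ.1 h.contMDiffOn).comp (contMDiff_const.prodMk contMDiff_id)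

theorem map_add [IsManifold I 1 M] [T2Space M] [I.Boundaryless] (h : IsGlobalFlow I X φ)
    (hX : ContMDiff I I.tangent 1 (fun q => (⟨q, X q⟩ : TangentBundle I M)))
    (s t : ℝ) (q : M) : φ (s + t) q = φ s (φ t q) :=
  congrFun (isMIntegralCurve_Ioo_eq_of_contMDiff_boundaryless (t₀ := 0) hX
    ((isMIntegralCurve h q).comp_add t) (isMIntegralCurve h (φ t q))
    (by simp only [comp_apply, zero_add, h.map_zero])) s

/-- The time-`t` map of a global flow, as a diffeomorphism with inverse `φ (-t)`. -/
def diffeomorph [IsManifold I 1 M] [T2Space M] [I.Boundaryless] (h : IsGlobalFlow I X φ)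
    (hX : ContMDiff I I.tangent 1 (fun q => (⟨q, X q⟩ : TangentBundle I M))) (t : ℝ) :
    Diffeomorph I I M M ∞ where
  toFun := φ t
  invFun := φ (-t)
  left_inv q := by rw [← map_add h hX, neg_add_cancel, h.map_zero]
  right_inv q := by rw [← map_add h hX, add_neg_cancel, h.map_zero]
  contMDiff_toFun := contMDiff h t
  contMDiff_invFun := contMDiff h (-t)

end IsGlobalFlow

end IntegralCurve

section Cotangent

variable {E H M : Type*} [NormedAddCommGroup E] [NormedSpace ℝ E] [TopologicalSpace H]
  {I : ModelWithCorners ℝ E H} [TopologicalSpace M] [ChartedSpace H M]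

theorem cotangentMap_of_forall_eq {Φ : M → M} (h : ∀ q, Φ q = q) (p : CotangentBundle I M) :
    cotangentMap I Φ p = p := by
  obtain rfl : Φ = id := funext h
  obtain ⟨q, p⟩ := p
  have hid : (mfderiv I I (@id M) q : E →L[ℝ] E).inverse = ContinuousLinearMap.id ℝ E := by
    rw [mfderiv_id]
    exact ContinuousLinearMap.inverse_id
  exact congrArg (TotalSpace.mk q)
    (congrArg (fun A : E →L[ℝ] E => ContinuousLinearMap.comp (M₂ := E) (M₃ := ℝ) p A) hid)

theorem cotangentMap_comp {Φ Φ' : M → M} (p : CotangentBundle I M)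
    (hΦ' : MDifferentiableAt I I Φ' (Φ p.1)) (hΦ : (mfderiv I I Φ p.1).IsInvertible) :
    cotangentMap I (Φ' ∘ Φ) p = cotangentMap I Φ' (cotangentMap I Φ p) := by
  obtain ⟨q, p⟩ := p
  have hcomp : (mfderiv I I (Φ' ∘ Φ) q).inverse =
      (mfderiv I I Φ q).inverse.comp (mfderiv I I Φ' (Φ q)).inverse := by
    rw [mfderiv_comp q hΦ' (mdifferentiableAt_of_isInvertible_mfderiv hΦ)]
    exact hΦ.inverse_comp_of_right
  exact congrArg (TotalSpace.mk (Φ' (Φ q)))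
    (congrArg (fun A => ContinuousLinearMap.comp p A) hcomp)

variable [IsManifold I 1 M]

theorem IsGlobalFlow.cotangentMap_add [T2Space M] [I.Boundaryless]
    {X : (q : M) → TangentSpace I q} {φ : ℝ → M → M} (h : IsGlobalFlow I X φ)
    (hX : ContMDiff I I.tangent 1 (fun q => (⟨q, X q⟩ : TangentBundle I M)))
    (s t : ℝ) (p : CotangentBundle I M) :
    cotangentMap I (φ (s + t)) p = cotangentMap I (φ s) (cotangentMap I (φ t) p) := by
  rw [show φ (s + t) = φ s ∘ φ t from funext fun q => IsGlobalFlow.map_add h hX s t q]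
  exact cotangentMap_comp p ((IsGlobalFlow.contMDiff h s).mdifferentiable (by simp) _)
    (isInvertible_mfderiv_diffeomorph (by simp) (IsGlobalFlow.diffeomorph h hX t) _)

variable {E' H' N : Type*} [NormedAddCommGroup E'] [NormedSpace ℝ E'] [TopologicalSpace H']
  {J : ModelWithCorners ℝ E' H'} [TopologicalSpace N] [ChartedSpace H' N]
  (Ψ : Diffeomorph J (I.prod 𝓘(ℝ, E →L[ℝ] ℝ)) N (CotangentBundle I M) ∞)

/-- The lift of `Φ` to the cotangent bundle, read through an identification `Ψ` of the cotangent
bundle with a manifold `N`. -/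
def cotangentMapIn (Φ : M → M) (x : N) : N :=
  Ψ.symm (cotangentMap I Φ (Ψ x))

theorem apply_cotangentMapIn (Φ : M → M) (x : N) :
    Ψ (cotangentMapIn Ψ Φ x) = cotangentMap I Φ (Ψ x) :=
  Ψ.apply_symm_apply _

theorem cotangentMapIn_of_forall_eq {Φ : M → M} (h : ∀ q, Φ q = q) (x : N) :
    cotangentMapIn Ψ Φ x = x := by
  rw [cotangentMapIn, cotangentMap_of_forall_eq h, Ψ.symm_apply_apply]

theorem IsGlobalFlow.cotangentMapIn_add [T2Space M] [I.Boundaryless]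
    {X : (q : M) → TangentSpace I q} {φ : ℝ → M → M} (h : IsGlobalFlow I X φ)
    (hX : ContMDiff I I.tangent 1 (fun q => (⟨q, X q⟩ : TangentBundle I M)))
    (s t : ℝ) (x : N) :
    cotangentMapIn Ψ (φ (s + t)) x = cotangentMapIn Ψ (φ s) (cotangentMapIn Ψ (φ t) x) := by
  simp only [cotangentMapIn, Ψ.apply_symm_apply, IsGlobalFlow.cotangentMap_add h hX]

theorem hasMFDerivAt_cotangentMap_of_cotangentMapIn {φ : ℝ → M → M} (hφ : ∀ q, φ 0 q = q) {x : N}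
    {z : TangentSpace J x} (hz : HasMFDerivAt 𝓘(ℝ, ℝ) J (fun t => cotangentMapIn Ψ (φ t) x) 0
      ((1 : ℝ →L[ℝ] ℝ).smulRight z)) :
    HasMFDerivAt 𝓘(ℝ, ℝ) (I.prod 𝓘(ℝ, E →L[ℝ] ℝ)) (fun t => cotangentMap I (φ t) (Ψ x)) 0
      ((1 : ℝ →L[ℝ] ℝ).smulRight (mfderiv J (I.prod 𝓘(ℝ, E →L[ℝ] ℝ)) Ψ x z)) := by
  have hΨ : HasMFDerivAt J (I.prod 𝓘(ℝ, E →L[ℝ] ℝ)) Ψ (cotangentMapIn Ψ (φ 0) x)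
      (mfderiv J (I.prod 𝓘(ℝ, E →L[ℝ] ℝ)) Ψ x : TangentSpace J x →L[ℝ] _) := by
    rw [cotangentMapIn_of_forall_eq Ψ hφ]
    exact (Ψ.mdifferentiable (by simp) x).hasMFDerivAt
  have hvelocity := ContinuousLinearMap.comp_toSpanSingleton
    (mfderiv J (I.prod 𝓘(ℝ, E →L[ℝ] ℝ)) Ψ x : E' →L[ℝ] E × (E →L[ℝ] ℝ)) (z : E')
  exact ((hΨ.comp (0 : ℝ) hz).congr_mfderiv hvelocity).congr_of_eventuallyEq
    (Filter.Eventually.of_forall fun t => (apply_cotangentMapIn Ψ (φ t) x).symm)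

theorem isCotangentLift_iff_mpullback_eq {X : (q : M) → TangentSpace I q}
    {Z : (x : N) → TangentSpace J x} (hex : ∃ D φ, IsFlowOn I X D φ)
    (hZ : ∀ D φ, IsFlowOn I X D φ → ∀ x, HasMFDerivAt 𝓘(ℝ, ℝ) J
      (fun t => cotangentMapIn Ψ (φ t) x) 0 ((1 : ℝ →L[ℝ] ℝ).smulRight (Z x)))
    (Y : (p : CotangentBundle I M) → TangentSpace (I.prod 𝓘(ℝ, E →L[ℝ] ℝ)) p) :
    IsCotangentLift I X Y ↔
      VectorField.mpullback J (I.prod 𝓘(ℝ, E →L[ℝ] ℝ)) Ψ Y = Z := by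
  constructor
  · rintro ⟨D, φ, h, hY⟩
    ext x
    have hderiv := hasMFDerivAt_unique (hY (Ψ x))
      (hasMFDerivAt_cotangentMap_of_cotangentMapIn Ψ h.map_zero (hZ D φ h x))
    have hvelocity : Y (Ψ x) = mfderiv J (I.prod 𝓘(ℝ, E →L[ℝ] ℝ)) Ψ x (Z x) :=
      (ContinuousLinearMap.toSpanSingleton_inj (R₁ := ℝ) (M₂ := E × (E →L[ℝ] ℝ))
        (f := Y (Ψ x)) (f' := mfderiv J (I.prod 𝓘(ℝ, E →L[ℝ] ℝ)) Ψ x (Z x))).1 hderiv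
    rw [VectorField.mpullback_apply, hvelocity,
      (isInvertible_mfderiv_diffeomorph (by simp) Ψ x).inverse_apply_self]
  · rintro rfl
    obtain ⟨D, φ, h⟩ := hex
    refine ⟨D, φ, h, fun p => ?_⟩
    obtain ⟨x, rfl⟩ := Ψ.surjective p
    have hlift := hasMFDerivAt_cotangentMap_of_cotangentMapIn Ψ h.map_zero (hZ D φ h x)
    rwa [VectorField.mpullback_apply,
      (isInvertible_mfderiv_diffeomorph (by simp) Ψ x).self_apply_inverse] at hlift

end Cotangent

section Dual

variable {𝕜 E : Type*} [NontriviallyNormedField 𝕜] [CompleteSpace 𝕜] [NormedAddCommGroup E]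
  [NormedSpace 𝕜 E] [FiniteDimensional 𝕜 E]

/-- The coordinates of a functional in the basis dual to `b`, i.e. its values on `b`. -/
def dualEquivFun {ι : Type*} (b : Module.Basis ι 𝕜 E) :
    (E →L[𝕜] 𝕜) ≃L[𝕜] (ι → 𝕜) :=
  ((LinearMap.toContinuousLinearMap (𝕜 := 𝕜) (E := E) (F' := 𝕜)).symm.trans
    (b.constr 𝕜).symm).toContinuousLinearEquiv

theorem contMDiff_dual_of_apply {E' H' N : Type*} [NormedAddCommGroup E'] [NormedSpace 𝕜 E']
    [TopologicalSpace H'] {J : ModelWithCorners 𝕜 E' H'} [TopologicalSpace N] [ChartedSpace H' N]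
    {n : WithTop ℕ∞} {f : N → E →L[𝕜] 𝕜} (h : ∀ w, ContMDiff J 𝓘(𝕜, 𝕜) n (fun x => f x w)) :
    ContMDiff J 𝓘(𝕜, E →L[𝕜] 𝕜) n f := by
  let b := Module.finBasis 𝕜 E
  have hcoord : ContMDiff J 𝓘(𝕜, Fin (Module.finrank 𝕜 E) → 𝕜) n
      (fun x => dualEquivFun b (f x)) :=
    contMDiff_pi_space.2 fun i => h (b i)
  simpa only [comp_def, ContinuousLinearEquiv.coe_coe, ContinuousLinearEquiv.symm_apply_apply]
    using ((dualEquivFun b).symm : _ →L[𝕜] (E →L[𝕜] 𝕜)).contMDiff.comp hcoord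

theorem hasDerivAt_dual_of_basis {ι : Type*} [Finite ι] (b : Module.Basis ι 𝕜 E)
    {f : 𝕜 → E →L[𝕜] 𝕜} {χ : E →L[𝕜] 𝕜} {t : 𝕜}
    (h : ∀ i, HasDerivAt (fun s => f s (b i)) (χ (b i)) t) : HasDerivAt f χ t := by
  have := Fintype.ofFinite ι
  have hcoord : HasDerivAt (fun s => dualEquivFun b (f s)) (dualEquivFun b χ) t :=
    hasDerivAt_pi.2 h
  simpa only [comp_def, ContinuousLinearEquiv.coe_coe, ContinuousLinearEquiv.symm_apply_apply]
    using ((dualEquivFun b).symm : _ →L[𝕜] (E →L[𝕜] 𝕜)).hasFDerivAt.comp_hasDerivAt t hcoord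

end Dual

section Translation

variable {𝕜 E H G : Type*} [NontriviallyNormedField 𝕜] [NormedAddCommGroup E] [NormedSpace 𝕜 E]
  [TopologicalSpace H]
  {I : ModelWithCorners 𝕜 E H} [TopologicalSpace G] [ChartedSpace H G] [Group G]

/-- Left translation by `a` as a diffeomorphism. -/
def leftTranslation (I : ModelWithCorners 𝕜 E H) (n : WithTop ℕ∞) [LieGroup I n G] (a : G) :
    Diffeomorph I I G G n where
  toEquiv := Equiv.mulLeft a
  contMDiff_toFun := contMDiff_mul_left
  contMDiff_invFun := contMDiff_mul_left

/-- Right translation by `a` as a diffeomorphism. -/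
def rightTranslation (I : ModelWithCorners 𝕜 E H) (n : WithTop ℕ∞) [LieGroup I n G] (a : G) :
    Diffeomorph I I G G n where
  toEquiv := Equiv.mulRight a
  contMDiff_toFun := contMDiff_mul_right
  contMDiff_invFun := contMDiff_mul_right

theorem isInvertible_mfderiv_mul_left {n : WithTop ℕ∞} [LieGroup I n G] (hn : n ≠ 0) (a g : G) :
    (mfderiv I I (fun y : G => a * y) g).IsInvertible :=
  isInvertible_mfderiv_diffeomorph hn (leftTranslation I n a) g

theorem isInvertible_mfderiv_mul_right {n : WithTop ℕ∞} [LieGroup I n G] (hn : n ≠ 0) (a g : G) :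
    (mfderiv I I (fun y : G => y * a) g).IsInvertible :=
  isInvertible_mfderiv_diffeomorph hn (rightTranslation I n a) g

theorem mulInvariantVectorField_one (v : GroupLieAlgebra I G) :
    mulInvariantVectorField v (1 : G) = v := by
  have hid : HasMFDerivAt I I (fun y : G => 1 * y) 1 (ContinuousLinearMap.id 𝕜 E) :=
    (hasMFDerivAt_id (1 : G)).congr_of_eventuallyEq (Filter.Eventually.of_forall one_mul)
  exact DFunLike.congr_fun hid.mfderiv v

section MinSmoothness

variable [LieGroup I (minSmoothness 𝕜 3) G]

theorem mfderiv_mul_left_mulInvariantVectorField (v : GroupLieAlgebra I G) (a g : G) :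
    mfderiv I I (fun y : G => a * y) g (mulInvariantVectorField v g) =
      mulInvariantVectorField v (a * g) := by
  have hn : minSmoothness 𝕜 3 ≠ 0 := (lt_of_lt_of_le (by simp) le_minSmoothness).ne'
  have h := isInvertible_mfderiv_mul_left (I := I) hn a g
  rw [← congrFun (mpullback_mulInvariantVectorField a v) g, VectorField.mpullback_apply,
    h.self_apply_inverse]

theorem mfderiv_inv_mul_mulInvariantVectorField (a : G) (w : GroupLieAlgebra I G) :
    (mfderiv I I (fun y : G => a⁻¹ * y) a : TangentSpace I a → E) (mulInvariantVectorField w a) =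
      w := by
  rw [mfderiv_mul_left_mulInvariantVectorField, inv_mul_cancel]
  exact mulInvariantVectorField_one w

theorem mulInvariantVectorField_mfderiv_inv_mul (a : G) (u : TangentSpace I a) :
    mulInvariantVectorField (I := I) (G := G)
      ((mfderiv I I (fun y : G => a⁻¹ * y) a : TangentSpace I a → E) u) a = u := by
  have hn : minSmoothness 𝕜 3 ≠ 0 := (lt_of_lt_of_le (by simp) le_minSmoothness).ne'
  exact (isInvertible_mfderiv_mul_left hn a⁻¹ a).injective
    (mfderiv_inv_mul_mulInvariantVectorField a _)

theorem mlieBracket_mulInvariantVectorField [CompleteSpace E] (v w : GroupLieAlgebra I G) (a : G) :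
    VectorField.mlieBracket I (mulInvariantVectorField v) (mulInvariantVectorField w) a =
      mulInvariantVectorField ⁅v, w⁆ a := by
  rw [GroupLieAlgebra.bracket_def, mulInvariantVector_mlieBracket]

end MinSmoothness

variable [LieGroup I ∞ G]

theorem contMDiff_infty_mulInvariantVectorField (v : GroupLieAlgebra I G) :
    ContMDiff I I.tangent ∞ (fun g : G => (mulInvariantVectorField v g : TangentBundle I G)) := by
  have hmul : ContMDiff I I.tangent ∞ (fun g : G =>
      (⟨g * 1, mfderiv I I (fun x : G => g * x) 1 v⟩ : TangentBundle I G)) := by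
    intro g₀
    have hcoord : ContMDiffAt I 𝓘(𝕜, E →L[𝕜] E) ∞ (inTangentCoordinates I I (fun _ : G => (1 : G))
        (fun g : G => g * 1) (fun g => mfderiv I I (fun x : G => g * x) 1) g₀) g₀ :=
      ContMDiffAt.mfderiv (fun g x : G => g * x) (fun _ => 1) (contMDiff_mul I ∞).contMDiffAt
        contMDiffAt_const le_rfl
    have hv : ContMDiffAt I I.tangent ∞ (fun _ : G => (⟨1, v⟩ : TangentBundle I G)) g₀ :=
      contMDiffAt_const
    exact ContMDiffAt.clm_apply_of_inCoordinates (E₁ := (TangentSpace I : G → Type _))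
      (E₂ := (TangentSpace I : G → Type _)) (b₁ := fun _ : G => (1 : G))
      (b₂ := fun g : G => g * 1) (ϕ := fun g => mfderiv I I (fun x : G => g * x) 1)
      (v := fun _ : G => v) hcoord hv contMDiff_mul_right.contMDiffAt
  have hmk : ∀ x y : G, x = y → ∀ w : E, (⟨x, w⟩ : TangentBundle I G) = ⟨y, w⟩ := by
    rintro x _ rfl w
    rfl
  convert! hmul using 2 with g
  exact hmk _ _ (mul_one g).symm _

end Translation

section DualCombination

variable {E H G : Type*} [NormedAddCommGroup E] [NormedSpace ℝ E] [FiniteDimensional ℝ E]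
  [TopologicalSpace H] {I : ModelWithCorners ℝ E H} [TopologicalSpace G] [ChartedSpace H G]
  [Group G] {ι : Type*} [Fintype ι] (b : Module.Basis ι ℝ (GroupLieAlgebra I G))

theorem dualCombination_apply (β : ι → ℝ) (w : GroupLieAlgebra I G) :
    dualCombination I b β w = ∑ k, β k * b.repr w k := by
  change (∑ k, β k • b.coord k : GroupLieAlgebra I G →ₗ[ℝ] ℝ) w = _
  simp

theorem dualEquivFun_dualCombination (β : ι → ℝ) :
    dualEquivFun (E := E) b (dualCombination I b β) = β := by
  classical
  ext i
  refine (dualCombination_apply b β (b i)).trans ?_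
  simp [Finsupp.single_apply]

theorem dualCombination_bracket (β : ι → ℝ) (i j : ι) :
    dualCombination I b β (⁅b i, b j⁆ : GroupLieAlgebra I G) =
      ∑ k, structureConstant I b i j k * β k := by
  simp only [dualCombination_apply, structureConstant, mul_comm]

end DualCombination

section LeftTrivialization

variable {E H G : Type*} [NormedAddCommGroup E] [NormedSpace ℝ E] [TopologicalSpace H]
  {I : ModelWithCorners ℝ E H} [TopologicalSpace G] [ChartedSpace H G] [Group G]

/-- The functional `w ↦ p (w^L)` on the Lie algebra, where `w^L` is the left-invariant field of `w`:
the fibre component of the inverse of `leftCovector`. -/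
def leftFunctional (p : CotangentBundle I G) : E →L[ℝ] ℝ :=
  ContinuousLinearMap.comp (M₁ := E) (M₂ := E) (M₃ := ℝ) p.2 (mfderiv I I (fun y : G => p.1 * y) 1)

variable [LieGroup I ∞ G]

theorem leftFunctional_leftCovector (x : G × (E →L[ℝ] ℝ)) :
    leftFunctional (leftCovector I x) = x.2 := by
  ext w
  exact congrArg x.2 (mfderiv_inv_mul_mulInvariantVectorField x.1 w)

theorem leftCovector_leftFunctional (p : CotangentBundle I G) :
    leftCovector I (p.1, leftFunctional p) = p := by
  obtain ⟨a, p⟩ := p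
  refine congrArg (TotalSpace.mk a) ?_
  ext w
  exact congrArg p (mulInvariantVectorField_mfderiv_inv_mul a w)

theorem continuousLinearMapAt_trivializationAt_one {x y : G} (hx : x = 1) (hy : y = 1) (u : E) :
    ((trivializationAt E (TangentSpace I : G → Type _) x).continuousLinearMapAt ℝ y :
      TangentSpace I y →L[ℝ] E) u = u := by
  subst hx hy
  rw [TangentBundle.continuousLinearMapAt_trivializationAt (mem_chart_source H 1),
    mfderiv_extChartAt_self]
  rfl

theorem contMDiff_leftCovector :
    ContMDiff (I.prod 𝓘(ℝ, E →L[ℝ] ℝ)) (I.prod 𝓘(ℝ, E →L[ℝ] ℝ)) ∞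
      (leftCovector I : G × (E →L[ℝ] ℝ) → CotangentBundle I G) := by
  rintro ⟨a₀, ψ₀⟩
  rw [contMDiffAt_hom_bundle]
  refine ⟨contMDiffAt_fst, ?_⟩
  have hmul : ContMDiffAt I 𝓘(ℝ, E →L[ℝ] E) ∞ (inTangentCoordinates I I (fun a : G => a)
      (fun a : G => a⁻¹ * a) (fun a => mfderiv I I (fun y : G => a⁻¹ * y) a) a₀) a₀ :=
    ContMDiffAt.mfderiv (fun a y : G => a⁻¹ * y) (fun a => a)
      (((contMDiff_inv I ∞).comp contMDiff_fst).mul contMDiff_snd).contMDiffAt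
      contMDiffAt_id le_rfl
  have hfst : ContMDiffAt (I.prod 𝓘(ℝ, E →L[ℝ] ℝ)) I ∞
      (Prod.fst : G × (E →L[ℝ] ℝ) → G) (a₀, ψ₀) := contMDiffAt_fst
  have hsnd : ContMDiffAt (I.prod 𝓘(ℝ, E →L[ℝ] ℝ)) 𝓘(ℝ, E →L[ℝ] ℝ) ∞
      (Prod.snd : G × (E →L[ℝ] ℝ) → E →L[ℝ] ℝ) (a₀, ψ₀) := contMDiffAt_snd
  refine (hsnd.clm_comp (ContMDiffAt.comp (a₀, ψ₀) hmul hfst)).congr_of_eventuallyEq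
    (Filter.Eventually.of_forall fun x => ?_)
  ext w
  let u : E := (mfderiv I I (fun y : G => x.1⁻¹ * y) x.1 : TangentSpace I x.1 → E)
    ((trivializationAt E (TangentSpace I : G → Type _) a₀).symmL ℝ x.1 w)
  exact (DFunLike.congr_fun (Trivial.continuousLinearMapAt_trivialization ℝ G ℝ x.1)
    (x.2 u)).trans (congrArg x.2 (continuousLinearMapAt_trivializationAt_one (I := I)
      (inv_mul_cancel a₀) (inv_mul_cancel x.1) u).symm)

variable [FiniteDimensional ℝ E]

theorem contMDiff_leftFunctional :
    ContMDiff (I.prod 𝓘(ℝ, E →L[ℝ] ℝ)) 𝓘(ℝ, E →L[ℝ] ℝ) ∞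
      (leftFunctional : CotangentBundle I G → E →L[ℝ] ℝ) := by
  refine contMDiff_dual_of_apply fun w => ?_
  have hw : ContMDiff (I.prod 𝓘(ℝ, E →L[ℝ] ℝ)) I.tangent ∞ (fun p : CotangentBundle I G =>
      (⟨p.1, mulInvariantVectorField (I := I) w p.1⟩ : TangentBundle I G)) :=
    (contMDiff_infty_mulInvariantVectorField w).comp (contMDiff_proj _)
  have hpair : ContMDiff (I.prod 𝓘(ℝ, E →L[ℝ] ℝ)) (I.prod 𝓘(ℝ, ℝ)) ∞
      (fun p : CotangentBundle I G =>
        (⟨p.1, p.2 (mulInvariantVectorField (I := I) w p.1)⟩ : TotalSpace ℝ (Trivial G ℝ))) :=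
    ContMDiff.clm_bundle_apply (b := fun p : CotangentBundle I G => p.1)
      (ϕ := fun p => p.2) contMDiff_id hw
  exact fun p => (contMDiffAt_totalSpace.1 (hpair p)).2

variable (I G) in
/-- The left trivialization `(a, ψ) ↦ (L_{a⁻¹})^* ψ` of the cotangent bundle of a Lie group. -/
def leftTrivialization :
    Diffeomorph (I.prod 𝓘(ℝ, E →L[ℝ] ℝ)) (I.prod 𝓘(ℝ, E →L[ℝ] ℝ))
      (G × (E →L[ℝ] ℝ)) (CotangentBundle I G) ∞ where
  toFun := leftCovector I
  invFun p := (p.1, leftFunctional p)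
  left_inv x := Prod.ext rfl (leftFunctional_leftCovector x)
  right_inv := leftCovector_leftFunctional
  contMDiff_toFun := contMDiff_leftCovector
  contMDiff_invFun := (contMDiff_proj _).prodMk contMDiff_leftFunctional

variable {ι : Type*} [Fintype ι] (b : Module.Basis ι ℝ (GroupLieAlgebra I G))

/-- The trivialization `(a, β) ↦ (L_{a⁻¹})^* (∑ k, β k • η_k)` of the cotangent bundle given by the
dual basis `η` of a basis of the Lie algebra. -/
def basisTrivialization : Diffeomorph (I.prod 𝓘(ℝ, ι → ℝ)) (I.prod 𝓘(ℝ, E →L[ℝ] ℝ))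
    (G × (ι → ℝ)) (CotangentBundle I G) ∞ where
  toFun x := leftCovector I (x.1, (dualEquivFun (E := E) b).symm x.2)
  invFun p := (p.1, dualEquivFun (E := E) b (leftFunctional p))
  left_inv x := Prod.ext rfl (by
    simp only [leftFunctional_leftCovector, ContinuousLinearEquiv.apply_symm_apply])
  right_inv p := by
    simp only [ContinuousLinearEquiv.symm_apply_apply, leftCovector_leftFunctional]
  contMDiff_toFun := contMDiff_leftCovector.comp (contMDiff_fst.prodMk
    (((dualEquivFun (E := E) b).symm : (ι → ℝ) →L[ℝ] (E →L[ℝ] ℝ)).contMDiff.comp contMDiff_snd))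
  contMDiff_invFun := (contMDiff_proj _).prodMk
    ((dualEquivFun (E := E) b : (E →L[ℝ] ℝ) →L[ℝ] (ι → ℝ)).contMDiff.comp
      contMDiff_leftFunctional)

theorem basisTrivialization_apply (x : G × (ι → ℝ)) :
    basisTrivialization b x = leftCovector I (x.1, dualCombination I b x.2) := by
  rw [← (dualEquivFun (E := E) b).symm_apply_eq.2 (dualEquivFun_dualCombination b x.2).symm]
  rfl

end LeftTrivialization

section BracketSum

variable {𝕜 E H M : Type*} [NontriviallyNormedField 𝕜] [NormedAddCommGroup E] [NormedSpace 𝕜 E]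
  [CompleteSpace E] [TopologicalSpace H] {I : ModelWithCorners 𝕜 E H} [TopologicalSpace M]
  [ChartedSpace H M] [IsManifold I 2 M]

theorem mlieBracket_sum_left {ι : Type*} {V : ι → (q : M) → TangentSpace I q}
    {W : (q : M) → TangentSpace I q} {q : M} (s : Finset ι)
    (hV : ∀ i ∈ s, MDifferentiableAt I I.tangent (fun x => (V i x : TangentBundle I M)) q) :
    VectorField.mlieBracket I (fun x => ∑ i ∈ s, V i x) W q =
      ∑ i ∈ s, VectorField.mlieBracket I (V i) W q := by
  classical
  induction s using Finset.induction_on with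
  | empty => exact congrFun VectorField.mlieBracket_zero_left q
  | insert i s hi ih =>
    have hs := fun j hj => hV j (Finset.mem_insert_of_mem hj)
    simp only [Finset.sum_insert hi]
    rw [← ih hs]
    exact VectorField.mlieBracket_add_left (hV i (Finset.mem_insert_self i s))
      (MDifferentiableAt.sum_section hs)

end BracketSum

section LiftedVelocity

variable {E H G : Type*} [NormedAddCommGroup E] [NormedSpace ℝ E] [TopologicalSpace H]
  {I : ModelWithCorners ℝ E H} [TopologicalSpace G] [ChartedSpace H G]

theorem IsFlowOn.hasMFDerivAt_prodMk {X : (a : G) → TangentSpace I a} {D : Set (ℝ × G)}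
    {φ : ℝ → G → G} (h : IsFlowOn I X D φ) {V : Type*} [NormedAddCommGroup V] [NormedSpace ℝ V]
    {g : ℝ → V} {g' : V} (hg : HasDerivAt g g' 0) (a : G) :
    HasMFDerivAt 𝓘(ℝ, ℝ) (I.prod 𝓘(ℝ, V)) (fun t => (φ t a, g t)) 0
      ((1 : ℝ →L[ℝ] ℝ).smulRight ((X a, g') : E × V)) := by
  have hφ : HasMFDerivAt 𝓘(ℝ, ℝ) I (fun t => φ t a) 0
      ((1 : ℝ →L[ℝ] ℝ).smulRight (X a : E) : ℝ →L[ℝ] E) := by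
    have h0 := h.hasMFDerivAt 0 a (h.zero_mem a)
    rwa [h.map_zero] at h0
  have hpair (u : E) : ((1 : ℝ →L[ℝ] ℝ).smulRight u).prod ((1 : ℝ →L[ℝ] ℝ).smulRight g') =
      (1 : ℝ →L[ℝ] ℝ).smulRight (u, g') := by
    ext <;> simp
  exact (hφ.prodMk (hasDerivAt_iff_hasFDerivAt.1 hg).hasMFDerivAt).congr_mfderiv (hpair (X a))

variable [Group G] [LieGroup I ∞ G]

theorem contMDiff_frameField {ι : Type*} [Fintype ι] (b : Module.Basis ι ℝ (GroupLieAlgebra I G))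
    {f : ι → G → ℝ} (hf : ∀ i, ContMDiff I 𝓘(ℝ, ℝ) ∞ (f i)) :
    ContMDiff I I.tangent ∞ (fun a => (⟨a, frameField I b f a⟩ : TangentBundle I G)) :=
  ContMDiff.sum_section (t := fun i a => f i a • mulInvariantVectorField (b i) a) fun i _ =>
    (hf i).smul_section (contMDiff_infty_mulInvariantVectorField (b i))

theorem leftCovector_apply_mulInvariantVectorField (x : G × (E →L[ℝ] ℝ))
    (w : GroupLieAlgebra I G) :
    (leftCovector I x).2 (mulInvariantVectorField w x.1) = x.2 w :=
  congrArg x.2 (mfderiv_inv_mul_mulInvariantVectorField x.1 w)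

theorem IsFlowOn.hasDerivAt_leftFunctional_apply [CompleteSpace E] [I.Boundaryless]
    {X : (a : G) → TangentSpace I a} {D : Set (ℝ × G)} {φ : ℝ → G → G} (h : IsFlowOn I X D φ)
    (p : CotangentBundle I G) (w : GroupLieAlgebra I G) :
    HasDerivAt (fun t => leftFunctional (cotangentMap I (φ t) p) w)
      (p.2 (VectorField.mlieBracket I X (mulInvariantVectorField w) p.1)) 0 :=
  (ContinuousLinearMap.hasFDerivAt (E := E) (F := ℝ) p.2).comp_hasDerivAt (0 : ℝ)
    (h.hasDerivAt_mpullback (mdifferentiableAt_mulInvariantVectorField w))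

theorem mlieBracket_frameField [CompleteSpace E] {ι : Type*} [Fintype ι]
    (b : Module.Basis ι ℝ (GroupLieAlgebra I G)) {f : ι → G → ℝ} {a : G}
    (hf : ∀ i, MDifferentiableAt I 𝓘(ℝ, ℝ) (f i) a) (w : GroupLieAlgebra I G) :
    VectorField.mlieBracket I (frameField I b f) (mulInvariantVectorField w) a =
      ∑ i, (f i a • mulInvariantVectorField ⁅b i, w⁆ a -
        derivAlong I (mulInvariantVectorField w) (f i) a • mulInvariantVectorField (b i) a) := by
  have hv := fun i => mdifferentiableAt_mulInvariantVectorField (I := I) (g := a) (b i)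
  refine (mlieBracket_sum_left Finset.univ fun i _ => (hf i).smul_section (hv i)).trans
    (Finset.sum_congr rfl fun i _ => ?_)
  refine (VectorField.mlieBracket_smul_left (hf i) (hv i)).trans ?_
  rw [mlieBracket_mulInvariantVectorField, sub_eq_neg_add, neg_smul]
  rfl

variable [FiniteDimensional ℝ E]

theorem IsFlowOn.hasMFDerivAt_cotangentMapIn_leftTrivialization [I.Boundaryless]
    {v : GroupLieAlgebra I G} {D : Set (ℝ × G)} {φ : ℝ → G → G}
    (h : IsFlowOn I (mulInvariantVectorField v) D φ) (x : G × (E →L[ℝ] ℝ)) :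
    HasMFDerivAt 𝓘(ℝ, ℝ) (I.prod 𝓘(ℝ, E →L[ℝ] ℝ))
      (fun t => cotangentMapIn (leftTrivialization G I) (φ t) x) 0
      ((1 : ℝ →L[ℝ] ℝ).smulRight (leftCoadField I v x)) := by
  have : CompleteSpace E := FiniteDimensional.complete ℝ E
  refine h.hasMFDerivAt_prodMk (hasDerivAt_dual_of_basis (Module.finBasis ℝ E) fun i => ?_) x.1
  refine (h.hasDerivAt_leftFunctional_apply (leftCovector I x) _).congr_deriv ?_
  refine (congrArg (leftCovector I x).2 (mlieBracket_mulInvariantVectorField v _ x.1)).trans ?_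
  exact leftCovector_apply_mulInvariantVectorField x _

variable {ι : Type*} [Fintype ι] (b : Module.Basis ι ℝ (GroupLieAlgebra I G))

theorem adjointRHS_eq_leftCovector_mlieBracket {f : ι → G → ℝ} {a : G}
    (hf : ∀ i, MDifferentiableAt I 𝓘(ℝ, ℝ) (f i) a) (β : ι → ℝ) (j : ι) :
    adjointRHS I b f a β j = (leftCovector I (a, dualCombination I b β)).2
      (VectorField.mlieBracket I (frameField I b f) (mulInvariantVectorField (b j)) a) := by
  have : CompleteSpace E := FiniteDimensional.complete ℝ E
  -- `map_sum` and `map_smul` need the functional typed at `a` itself, not at `(leftCovector …).1`.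
  obtain ⟨p, hp⟩ : ∃ p : TangentSpace I a →ₗ[ℝ] ℝ,
      ∀ u, p u = (leftCovector I (a, dualCombination I b β)).2 u :=
    ⟨ContinuousLinearMap.toLinearMap (M := E) (M₂ := ℝ)
      (leftCovector I (a, dualCombination I b β)).2, fun _ => rfl⟩
  have hleft : ∀ w, p (mulInvariantVectorField w a) = dualCombination I b β w := fun w =>
    (hp _).trans (leftCovector_apply_mulInvariantVectorField (a, dualCombination I b β) w)
  have hbasis : ∀ i, dualCombination I b β (b i) = β i :=
    congrFun (dualEquivFun_dualCombination b β)
  rw [← hp, mlieBracket_frameField b hf]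
  simp only [map_sum, map_sub, map_smul, hleft, dualCombination_bracket, hbasis,
    smul_eq_mul, Finset.sum_sub_distrib, adjointRHS, Finset.mul_sum, mul_assoc]

theorem IsFlowOn.hasMFDerivAt_cotangentMapIn_basisTrivialization [I.Boundaryless]
    {f : ι → G → ℝ} {D : Set (ℝ × G)} {φ : ℝ → G → G} (h : IsFlowOn I (frameField I b f) D φ)
    {x : G × (ι → ℝ)} (hf : ∀ i, MDifferentiableAt I 𝓘(ℝ, ℝ) (f i) x.1) :
    HasMFDerivAt 𝓘(ℝ, ℝ) (I.prod 𝓘(ℝ, ι → ℝ))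
      (fun t => cotangentMapIn (basisTrivialization b) (φ t) x) 0
      ((1 : ℝ →L[ℝ] ℝ).smulRight (adjointField I b f x)) := by
  have : CompleteSpace E := FiniteDimensional.complete ℝ E
  refine h.hasMFDerivAt_prodMk (hasDerivAt_pi.2 fun j => ?_) x.1
  rw [basisTrivialization_apply, adjointRHS_eq_leftCovector_mlieBracket b hf]
  exact h.hasDerivAt_leftFunctional_apply (leftCovector I (x.1, dualCombination I b x.2)) (b j)

end LiftedVelocity

section Exponential

variable {E H G : Type*} [NormedAddCommGroup E] [NormedSpace ℝ E] [TopologicalSpace H]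
  {I : ModelWithCorners ℝ E H} [TopologicalSpace G] [ChartedSpace H G] [Group G]

theorem IsOneParameterSubgroup.map_zero {v : GroupLieAlgebra I G} {γ : ℝ → G}
    (h : IsOneParameterSubgroup I γ v) : γ 0 = 1 := by
  have hadd := h.map_add 0 0
  rwa [add_zero, left_eq_mul] at hadd

variable [LieGroup I ∞ G]

theorem hasMFDerivAt_mul_left_of_mulInvariantVectorField {v : GroupLieAlgebra I G} {γ : ℝ → G}
    {t : ℝ} (h : HasMFDerivAt 𝓘(ℝ, ℝ) I γ t
      ((1 : ℝ →L[ℝ] ℝ).smulRight (mulInvariantVectorField v (γ t)))) (a : G) :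
    HasMFDerivAt 𝓘(ℝ, ℝ) I (fun s => a * γ s) t
      ((1 : ℝ →L[ℝ] ℝ).smulRight (mulInvariantVectorField v (a * γ t))) := by
  refine ((((contMDiff_mul_left (I := I) (n := ∞) (a := a)).mdifferentiable (by simp)
    (γ t)).hasMFDerivAt).comp t h).congr_mfderiv ?_
  rw [← mfderiv_mul_left_mulInvariantVectorField]
  exact ContinuousLinearMap.comp_toSpanSingleton
    (mfderiv I I (fun y : G => a * y) (γ t) : E →L[ℝ] E) (mulInvariantVectorField v (γ t) : E)

theorem IsOneParameterSubgroup.hasMFDerivAt_mul_left {v : GroupLieAlgebra I G} {γ : ℝ → G}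
    (h : IsOneParameterSubgroup I γ v) (a : G) :
    HasMFDerivAt 𝓘(ℝ, ℝ) I (fun t => a * γ t) 0
      ((1 : ℝ →L[ℝ] ℝ).smulRight (mulInvariantVectorField v a)) := by
  have hγ : HasMFDerivAt 𝓘(ℝ, ℝ) I γ 0
      ((1 : ℝ →L[ℝ] ℝ).smulRight (mulInvariantVectorField v (γ 0))) := by
    rw [h.map_zero, mulInvariantVectorField_one]
    exact h.hasMFDerivAt
  have hmul := hasMFDerivAt_mul_left_of_mulInvariantVectorField hγ a
  rwa [h.map_zero, mul_one] at hmul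

theorem IsOneParameterSubgroup.isGlobalFlow {v : GroupLieAlgebra I G} {γ : ℝ → G}
    (h : IsOneParameterSubgroup I γ v) :
    IsGlobalFlow I (mulInvariantVectorField v) (fun t a => a * γ t) :=
  isGlobalFlow_of_map_add (contMDiff_snd.mul (h.contMDiff.comp contMDiff_fst))
    (fun a => by rw [h.map_zero, mul_one])
    (fun s t a => by rw [add_comm, h.map_add, mul_assoc]) h.hasMFDerivAt_mul_left

theorem IsOneParameterSubgroup.isMIntegralCurve {v : GroupLieAlgebra I G} {γ : ℝ → G}
    (h : IsOneParameterSubgroup I γ v) : IsMIntegralCurve γ (mulInvariantVectorField v) := by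
  simpa only [one_mul] using IsGlobalFlow.isMIntegralCurve h.isGlobalFlow 1

theorem IsOneParameterSubgroup.comp_mul {v : GroupLieAlgebra I G} {γ : ℝ → G}
    (h : IsOneParameterSubgroup I γ v) (t : ℝ) :
    IsOneParameterSubgroup I (fun s => γ (s * t)) (t • v) where
  map_add r s := by rw [add_mul, h.map_add]
  contMDiff := h.contMDiff.comp (contMDiff_id.mul contMDiff_const)
  hasMFDerivAt := by
    have hvelocity : ∀ s : ℝ, s = 0 → (mulInvariantVectorField v (γ s) : E) = v := by
      rintro _ rfl
      rw [h.map_zero, mulInvariantVectorField_one]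
    exact (h.isMIntegralCurve.comp_mul t 0).congr_mfderiv
      (congrArg (fun u : E => (1 : ℝ →L[ℝ] ℝ).smulRight (t • u)) (hvelocity _ (zero_mul t)))

variable [I.Boundaryless] [T2Space G]

theorem IsOneParameterSubgroup.unique {v : GroupLieAlgebra I G} {γ γ' : ℝ → G}
    (h : IsOneParameterSubgroup I γ v) (h' : IsOneParameterSubgroup I γ' v) : γ = γ' :=
  isMIntegralCurve_Ioo_eq_of_contMDiff_boundaryless (t₀ := 0)
    ((contMDiff_infty_mulInvariantVectorField v).of_le (by simp))
    h.isMIntegralCurve h'.isMIntegralCurve (by rw [h.map_zero, h'.map_zero])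

theorem IsOneParameterSubgroup.lieExp_smul {v : GroupLieAlgebra I G} {γ : ℝ → G}
    (h : IsOneParameterSubgroup I γ v) (t : ℝ) : lieExp I (t • v) = γ t := by
  have hspec := Classical.epsilon_spec (p := fun γ => IsOneParameterSubgroup I γ (t • v))
    ⟨_, h.comp_mul t⟩
  exact (congrFun (hspec.unique (h.comp_mul t)) 1).trans (by rw [one_mul])

theorem isOneParameterSubgroup_of_isMIntegralCurve {v : GroupLieAlgebra I G} {γ : ℝ → G}
    (h : IsMIntegralCurve γ (mulInvariantVectorField v)) (h0 : γ 0 = 1) :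
    IsOneParameterSubgroup I γ v where
  map_add s t := by
    have hleft : IsMIntegralCurve (fun t => γ s * γ t) (mulInvariantVectorField v) := fun t =>
      hasMFDerivAt_mul_left_of_mulInvariantVectorField (h t) (γ s)
    have heq := isMIntegralCurve_Ioo_eq_of_contMDiff_boundaryless (t₀ := 0)
      ((contMDiff_infty_mulInvariantVectorField v).of_le (by simp)) (h.comp_add s) hleft
      (by rw [comp_apply, zero_add, h0, mul_one])
    rw [add_comm]
    exact congrFun heq t
  contMDiff := contMDiff_of_isMIntegralCurve (contMDiff_infty_mulInvariantVectorField v) h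
  hasMFDerivAt := by
    have hzero := h 0
    rwa [h0, mulInvariantVectorField_one] at hzero

variable [CompleteSpace E]

theorem exists_isMIntegralCurve_mulInvariantVectorField (v : GroupLieAlgebra I G) :
    ∃ γ : ℝ → G, γ 0 = 1 ∧ IsMIntegralCurve γ (mulInvariantVectorField v) := by
  have hv := (contMDiff_infty_mulInvariantVectorField (I := I) (G := G) v).of_le
    (show (1 : WithTop ℕ∞) ≤ ∞ by simp)
  obtain ⟨γ, h0, hγ⟩ := exists_isMIntegralCurveAt_of_contMDiffAt_boundaryless (I := I) 0 (hv 1)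
  obtain ⟨ε, hε, hγ⟩ := isMIntegralCurveAt_iff'.1 hγ
  rw [Real.ball_eq_Ioo, zero_sub, zero_add] at hγ
  -- Left translates of `γ` are integral curves on the same interval, so the field is complete.
  refine exists_isMIntegralCurve_of_isMIntegralCurveOn hv hε (fun x => ⟨fun s => x * γ s,
    (congrArg (x * ·) h0).trans (mul_one x), fun t ht => ?_⟩) 1
  exact (hasMFDerivAt_mul_left_of_mulInvariantVectorField
    ((hγ t ht).hasMFDerivAt (Ioo_mem_nhds ht.1 ht.2)) x).hasMFDerivWithinAt

theorem isOneParameterSubgroup_lieExp (v : GroupLieAlgebra I G) :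
    IsOneParameterSubgroup I (fun t : ℝ => lieExp I (t • v)) v := by
  obtain ⟨γ, h0, hγ⟩ := exists_isMIntegralCurve_mulInvariantVectorField v
  have h := isOneParameterSubgroup_of_isMIntegralCurve hγ h0
  rwa [show (fun t : ℝ => lieExp I (t • v)) = γ from funext h.lieExp_smul]

theorem isGlobalFlow_mul_lieExp (v : GroupLieAlgebra I G) :
    IsGlobalFlow I (mulInvariantVectorField v) (fun t a => a * lieExp I (t • v)) :=
  (isOneParameterSubgroup_lieExp v).isGlobalFlow

end Exponential

section Adjoint

variable {E H G : Type*} [NormedAddCommGroup E] [NormedSpace ℝ E] [TopologicalSpace H]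
  {I : ModelWithCorners ℝ E H} [TopologicalSpace G] [ChartedSpace H G] [Group G] [LieGroup I ∞ G]

theorem contMDiff_conj : ContMDiff (I.prod I) I ∞ (fun p : G × G => p.1 * p.2 * p.1⁻¹) :=
  (contMDiff_fst.mul contMDiff_snd).mul ((contMDiff_inv I ∞).comp contMDiff_fst)

theorem hasMFDerivAt_conj (g : G) :
    HasMFDerivAt I I (fun x : G => g * x * g⁻¹) 1 (lieAd I g : E →L[ℝ] E) := by
  have hconj : ContMDiff I I ∞ (fun x : G => g * x * g⁻¹) :=
    contMDiff_conj.comp (contMDiff_const.prodMk contMDiff_id)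
  exact (hconj.mdifferentiable (by simp) 1).hasMFDerivAt

theorem symmL_trivializationAt_one (w : E) :
    ((trivializationAt E (TangentSpace I : G → Type _) 1).symmL ℝ 1 :
      E →L[ℝ] TangentSpace I (1 : G)) w = w :=
  (continuousLinearMapAt_trivializationAt_one (I := I) (G := G) rfl rfl _).symm.trans
    ((trivializationAt E (TangentSpace I : G → Type _) 1).continuousLinearMapAt_symmL
      (mem_baseSet_trivializationAt E (TangentSpace I : G → Type _) 1) w)

theorem contMDiff_lieAd :
    ContMDiff (M := G) (M' := E →L[ℝ] E) I 𝓘(ℝ, E →L[ℝ] E) ∞ (lieAd I) := by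
  intro g₀
  have hconj : ContMDiffAt I 𝓘(ℝ, E →L[ℝ] E) ∞ (inTangentCoordinates I I (fun _ : G => (1 : G))
      (fun g : G => g * 1 * g⁻¹) (fun g => mfderiv I I (fun x : G => g * x * g⁻¹) 1) g₀) g₀ :=
    ContMDiffAt.mfderiv (fun g x : G => g * x * g⁻¹) (fun _ => 1) contMDiff_conj.contMDiffAt
      contMDiffAt_const le_rfl
  refine hconj.congr_of_eventuallyEq (Filter.Eventually.of_forall fun g => ?_)
  ext w
  let A : E →L[ℝ] E := lieAd I g
  exact (congrArg A (symmL_trivializationAt_one (I := I) (G := G) w)).symm.trans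
    (continuousLinearMapAt_trivializationAt_one (I := I) (x := g₀ * 1 * g₀⁻¹)
      (y := g * 1 * g⁻¹) (by simp) (by simp) (A _)).symm

theorem mfderiv_mul_right_mulInvariantVectorField_lieAd (a g : G) (w : GroupLieAlgebra I G) :
    mfderiv I I (fun y : G => y * g) a (mulInvariantVectorField (lieAd I g w) a) =
      mulInvariantVectorField w (a * g) := by
  have hleft : ∀ c x : G, HasMFDerivAt I I (fun y : G => c * y) x _ := fun c x =>
    ((contMDiff_mul_left (n := ∞)).mdifferentiable (by simp) x).hasMFDerivAt
  have hright : HasMFDerivAt I I (fun y : G => y * g) (a * 1)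
      (mfderiv I I (fun y : G => y * g) a : TangentSpace I a →L[ℝ] _) := by
    rw [mul_one]
    exact ((contMDiff_mul_right (I := I) (n := ∞)).mdifferentiable (by simp) a).hasMFDerivAt
  have hmul : HasMFDerivAt I I (fun y : G => a * y * g) (g * 1 * g⁻¹)
      ((mfderiv I I (fun y : G => y * g) a : E →L[ℝ] E).comp
        (mfderiv I I (fun y : G => a * y) 1 : E →L[ℝ] E)) := by
    rw [mul_one, mul_inv_cancel]
    exact hright.comp (1 : G) (hleft a 1)
  have hcomp := HasMFDerivAt.comp (f := fun x : G => g * x * g⁻¹) (1 : G) hmul (hasMFDerivAt_conj g)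
  have hconj : (fun y => a * y * g) ∘ (fun x => g * x * g⁻¹) = fun x => a * g * x := by
    ext x
    simp [mul_assoc]
  rw [hconj] at hcomp
  exact DFunLike.congr_fun (hasMFDerivAt_unique hcomp (hleft (a * g) 1)) w

theorem cotangentMap_mul_right_leftCovector (g a : G) (ψ : E →L[ℝ] ℝ) :
    cotangentMap I (fun y => y * g) (leftCovector I (a, ψ)) =
      leftCovector I (a * g, lieCoAd I g ψ) := by
  rw [← leftCovector_leftFunctional (cotangentMap I (fun y => y * g) (leftCovector I (a, ψ)))]
  refine congrArg (fun χ : E →L[ℝ] ℝ => leftCovector I (a * g, χ))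
    (ContinuousLinearMap.ext fun w : GroupLieAlgebra I G => ?_)
  have hinverse : (mfderiv I I (fun y : G => y * g) a).inverse (mulInvariantVectorField w (a * g)) =
      mulInvariantVectorField (lieAd I g w) a := by
    rw [← mfderiv_mul_right_mulInvariantVectorField_lieAd,
      (isInvertible_mfderiv_mul_right (n := ∞) (by simp) g a).inverse_apply_self]
  have hvalue := leftCovector_apply_mulInvariantVectorField (I := I) (a, ψ) (lieAd I g w)
  rwa [← hinverse] at hvalue

end Adjoint

section LiftedFlow

variable {E H G : Type*} [NormedAddCommGroup E] [NormedSpace ℝ E] [FiniteDimensional ℝ E]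
  [TopologicalSpace H] {I : ModelWithCorners ℝ E H} [I.Boundaryless] [TopologicalSpace G]
  [T2Space G] [ChartedSpace H G] [Group G] [LieGroup I ∞ G]

theorem contMDiff_mul_lieExp_lieCoAd (v : GroupLieAlgebra I G) :
    ContMDiff (𝓘(ℝ, ℝ).prod (I.prod 𝓘(ℝ, E →L[ℝ] ℝ))) (I.prod 𝓘(ℝ, E →L[ℝ] ℝ)) ∞
      (uncurry fun (t : ℝ) (x : G × (E →L[ℝ] ℝ)) =>
        (x.1 * lieExp I (t • v), lieCoAd I (lieExp I (t • v)) x.2)) := by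
  have : CompleteSpace E := FiniteDimensional.complete ℝ E
  have hexp : ContMDiff (𝓘(ℝ, ℝ).prod (I.prod 𝓘(ℝ, E →L[ℝ] ℝ))) I ∞
      (fun p : ℝ × G × (E →L[ℝ] ℝ) => lieExp I (p.1 • v)) :=
    (isOneParameterSubgroup_lieExp v).contMDiff.comp contMDiff_fst
  have hAd : ContMDiff (M' := E →L[ℝ] E) (𝓘(ℝ, ℝ).prod (I.prod 𝓘(ℝ, E →L[ℝ] ℝ)))
      𝓘(ℝ, E →L[ℝ] E) ∞ (fun p : ℝ × G × (E →L[ℝ] ℝ) => lieAd I (lieExp I (p.1 • v))) :=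
    contMDiff_lieAd.comp hexp
  have hψ : ContMDiff (𝓘(ℝ, ℝ).prod (I.prod 𝓘(ℝ, E →L[ℝ] ℝ))) 𝓘(ℝ, E →L[ℝ] ℝ) ∞
      (fun p : ℝ × G × (E →L[ℝ] ℝ) => p.2.2) := contMDiff_snd.comp contMDiff_snd
  exact ((contMDiff_fst.comp contMDiff_snd).mul hexp).prodMk (hψ.clm_comp hAd)

theorem isGlobalFlow_leftCoadField (v : GroupLieAlgebra I G) :
    IsGlobalFlow (I.prod 𝓘(ℝ, E →L[ℝ] ℝ)) (leftCoadField I v)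
      (fun t (x : G × (E →L[ℝ] ℝ)) =>
        (x.1 * lieExp I (t • v), lieCoAd I (lieExp I (t • v)) x.2)) := by
  have : CompleteSpace E := FiniteDimensional.complete ℝ E
  have hflow := isGlobalFlow_mul_lieExp v
  have hlift : (fun (t : ℝ) (x : G × (E →L[ℝ] ℝ)) =>
      (x.1 * lieExp I (t • v), lieCoAd I (lieExp I (t • v)) x.2)) = fun t x =>
        cotangentMapIn (leftTrivialization G I) (fun y => y * lieExp I (t • v)) x := by
    funext t x
    exact (leftTrivialization G I).injective
      ((cotangentMap_mul_right_leftCovector (lieExp I (t • v)) x.1 x.2).symm.trans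
        (apply_cotangentMapIn (leftTrivialization G I) _ x).symm)
  have hsmooth := contMDiff_mul_lieExp_lieCoAd (I := I) (G := G) v
  rw [hlift] at hsmooth ⊢
  exact isGlobalFlow_of_map_add hsmooth (cotangentMapIn_of_forall_eq _ hflow.map_zero)
    (IsGlobalFlow.cotangentMapIn_add _ hflow
      ((contMDiff_infty_mulInvariantVectorField v).of_le (by simp)))
    (IsFlowOn.hasMFDerivAt_cotangentMapIn_leftTrivialization hflow)

theorem IsGlobalFlow.exists_adjoint {ι : Type*} [Fintype ι]
    (b : Module.Basis ι ℝ (GroupLieAlgebra I G)) {f : ι → G → ℝ}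
    (hf : ∀ i, ContMDiff I 𝓘(ℝ, ℝ) ∞ (f i)) {φ : ℝ → G → G}
    (h : IsGlobalFlow I (frameField I b f) φ) (a : G) (β₀ : ι → ℝ) :
    ∃ β : ℝ → ι → ℝ, β 0 = β₀ ∧
      (∀ t, cotangentMap I (φ t) (basisTrivialization b (a, β₀)) =
        basisTrivialization b (φ t a, β t)) ∧
      ∀ t j, HasDerivAt (fun s => β s j) (adjointRHS I b f (φ t a) (β t) j) t := by
  let lift t x := cotangentMapIn (basisTrivialization b) (φ t) x
  have hcurve : IsMIntegralCurve (fun t => lift t (a, β₀)) (adjointField I b f) :=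
    isMIntegralCurve_of_map_add (IsGlobalFlow.cotangentMapIn_add _ h
        ((contMDiff_frameField b hf).of_le (by simp)))
      (fun x => IsFlowOn.hasMFDerivAt_cotangentMapIn_basisTrivialization b h
        fun i => (hf i).mdifferentiable (by simp) x.1) (a, β₀)
  refine ⟨fun t => (lift t (a, β₀)).2, ?_, fun t => ?_, fun t => ?_⟩
  · exact congrArg Prod.snd (cotangentMapIn_of_forall_eq _ h.map_zero (a, β₀))
  · exact (apply_cotangentMapIn (basisTrivialization b) (φ t) (a, β₀)).symm
  · have hsnd : HasMFDerivAt 𝓘(ℝ, ℝ) 𝓘(ℝ, ι → ℝ) (fun s => (lift s (a, β₀)).2) t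
        ((1 : ℝ →L[ℝ] ℝ).smulRight (adjointRHS I b f (φ t a) (lift t (a, β₀)).2)) :=
      ((hasMFDerivAt_snd _).comp t (hcurve t)).congr_mfderiv
        (ContinuousLinearMap.comp_toSpanSingleton (ContinuousLinearMap.snd ℝ E (ι → ℝ)) _)
    exact hasDerivAt_pi.1 (hasDerivAt_iff_hasFDerivAt.2 hsnd.hasFDerivAt)

end LiftedFlow

end

theorem mainTheorem9 {E H G : Type*} [NormedAddCommGroup E] [NormedSpace ℝ E]
    [FiniteDimensional ℝ E] [TopologicalSpace H] (I : ModelWithCorners ℝ E H) [I.Boundaryless]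
    [TopologicalSpace G] [T2Space G] [ChartedSpace H G] [Group G] [LieGroup I ∞ G] :
    -- part 1: left-invariant fields, in the left trivialization `Θ : G × 𝔤* ≃ T*G`
    (∃ Θ : Diffeomorph (I.prod 𝓘(ℝ, E →L[ℝ] ℝ)) (I.prod 𝓘(ℝ, E →L[ℝ] ℝ))
        (G × (E →L[ℝ] ℝ)) (CotangentBundle I G) ∞,
      (∀ x, Θ x = leftCovector I x) ∧
      ∀ v : GroupLieAlgebra I G,
        IsGlobalFlow I (mulInvariantVectorField v) (fun t a => a * lieExp I (t • v)) ∧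
        (∀ Y : (p : CotangentBundle I G) → TangentSpace (I.prod 𝓘(ℝ, E →L[ℝ] ℝ)) p,
          IsCotangentLift I (mulInvariantVectorField v) Y ↔
            VectorField.mpullback (I.prod 𝓘(ℝ, E →L[ℝ] ℝ)) (I.prod 𝓘(ℝ, E →L[ℝ] ℝ)) Θ Y =
              leftCoadField I v) ∧
        (∀ (t : ℝ) (a : G) (ψ : E →L[ℝ] ℝ),
          cotangentMap I (fun y => y * lieExp I (t • v)) (Θ (a, ψ)) =
            Θ (a * lieExp I (t • v), lieCoAd I (lieExp I (t • v)) ψ)) ∧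
        IsGlobalFlow (I.prod 𝓘(ℝ, E →L[ℝ] ℝ)) (leftCoadField I v)
          (fun t (x : G × (E →L[ℝ] ℝ)) =>
            (x.1 * lieExp I (t • v), lieCoAd I (lieExp I (t • v)) x.2))) ∧
    -- part 2: the adjoint equation, in the trivialization given by a basis of the Lie algebra
    (∀ {ι : Type*} [Fintype ι] (b : Module.Basis ι ℝ (GroupLieAlgebra I G)),
      ∃ Ψ : Diffeomorph (I.prod 𝓘(ℝ, ι → ℝ)) (I.prod 𝓘(ℝ, E →L[ℝ] ℝ))
          (G × (ι → ℝ)) (CotangentBundle I G) ∞,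
        (∀ a β, Ψ (a, β) = leftCovector I (a, dualCombination I b β)) ∧
        ∀ f : ι → G → ℝ, (∀ i, ContMDiff I 𝓘(ℝ, ℝ) ∞ (f i)) →
          (∀ (D : Set (ℝ × G)) (φ : ℝ → G → G), IsFlowOn I (frameField I b f) D φ →
            ∀ Y : (p : CotangentBundle I G) → TangentSpace (I.prod 𝓘(ℝ, E →L[ℝ] ℝ)) p,
              IsCotangentLift I (frameField I b f) Y ↔
                VectorField.mpullback (I.prod 𝓘(ℝ, ι → ℝ)) (I.prod 𝓘(ℝ, E →L[ℝ] ℝ)) Ψ Y =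
                  adjointField I b f) ∧
          (∀ φ : ℝ → G → G, IsGlobalFlow I (frameField I b f) φ → ∀ (a : G) (β₀ : ι → ℝ),
            ∃ β : ℝ → ι → ℝ, β 0 = β₀ ∧
              (∀ t, cotangentMap I (φ t) (Ψ (a, β₀)) = Ψ (φ t a, β t)) ∧
              ∀ t j, HasDerivAt (fun s => β s j) (adjointRHS I b f (φ t a) (β t) j) t)) := by
  have : CompleteSpace E := FiniteDimensional.complete ℝ E
  refine ⟨⟨leftTrivialization G I, fun _ => rfl, fun v => ⟨isGlobalFlow_mul_lieExp v, ?_, ?_, ?_⟩⟩,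
    fun b => ⟨basisTrivialization b, fun a β => basisTrivialization_apply b (a, β),
      fun f hf => ⟨fun D φ h => ?_, fun φ h => ?_⟩⟩⟩
  · exact isCotangentLift_iff_mpullback_eq _ ⟨univ, _, isGlobalFlow_mul_lieExp v⟩
      fun D φ h => h.hasMFDerivAt_cotangentMapIn_leftTrivialization
  · exact fun t => cotangentMap_mul_right_leftCovector (lieExp I (t • v))
  · exact isGlobalFlow_leftCoadField v
  · exact isCotangentLift_iff_mpullback_eq _ ⟨D, φ, h⟩ fun D' φ' h' x =>
      h'.hasMFDerivAt_cotangentMapIn_basisTrivialization b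
        fun i => (hf i).mdifferentiable (by simp) x.1
  · exact h.exists_adjoint b hf
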